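/- **Setting.** Let $(X,Y)$ be a random vector in $\mathbb R^p\times\mathbb R^q$ with law $\mathbb P$, mean zero, and covariance matrices $\Sigma_x$, $\Sigma_y$, $\Sigma_{xy}$ (with $\Sigma_{yx}=\Sigma_{xy}^T$), where $\mathrm{rank}(\Sigma_{xy})=r\ge 1$. For $j=1,\dots,r$ the $j$-th pair of canonical directions $(u_j,v_j)$ is defined recursively as a maximizer of $u^T\Sigma_{xy}v$ subject to $u^T\Sigma_xu=v^T\Sigma_yv=1$ and $u^T\Sigma_xu_l=v^T\Sigma_yv_l=0$ for all $l<j$; the canonical correlation is $\Lambda_j=u_j^T\Sigma_{xy}v_j$. Put $U=[u_1,\dots,u_r]$ and $V=[v_1,\dots,v_r]$. For a matrix $A$, $D(A)$ is the set of indices of its nonzero rows, $s(A)$ the maximal number of nonzero entries in a column, and $\|A\|_{\infty,k}$ the maximal $\ell_k$-norm of a row. Let $\mathrm{Sig}_y=\min_{k\in D(V)}\max_{i\le r}|(v_i)_k|$. Let $B>1$. Call $\mathbb P$ *admissible* if $|D(U)|=s_x$, $|D(V)|=s_y$, $\Lambda_r\ge 1/B$, $\Lambda_{i-1}-\Lambda_i\ge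 1/B$ for $2\le i\le r$, and all eigenvalues of $\Sigma_x$ and of $\Sigma_y$ lie in $(1/B,B)$. The sub-Gaussian model $\mathcal P=\mathcal P(r,s_x,s_y,B)$ consists of the admissible laws for which $X$ and $Y$ are (individually) sub-Gaussian with a fixed parameter $K$, that is $E e^{t\langle a,X\rangle}\le e^{Kt^2/2}$ and $E e^{t\langle b,Y\rangle}\le e^{Kt^2/2}$ for all unit vectors $a,b$ and all $t\in\mathbb R$. The Gaussian model $\mathcal P_G$ consists of the admissible laws for which $(X,Y)$ is jointly Gaussian. **Algorithm.** From $n$ i.i.d. observations $(x_i,y_i)\sim\mathbb P$ compute from the first $\lfloor n/2\rfloor$ of them (measurable) estimators $\widehat U$ of $U$, with columns $\hat u_i$, and $\widehat\Phi$ of $\Sigma_y^{-1}$, and from the others the empirical cross-covariance matrix $\widehat\Sigma_{xy}=(n-\lfloor n/2\rfloor)^{-1}\sum_{i>\lfloor n/2\rfloor}x_iy_i^T$, with transpose $\widehat\Sigma_{yx}$. With $\widehat V^{clean}=\widehat\Phi\,\widehat\Sigma_{yx}\,\widehat U$, the algorithm RecoverSupp with cut-off $\mathrm{cut}$ returns $\widehat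 D(V)=\{k\in[q]: |\widehat V^{clean}_{kj}|>\mathrm{cut}\text{ for some }j\in[r]\}$. **Asymptotics.** $p,q,r,s_x,s_y$ may depend on $n$; $p+q\to\infty$ and $\log(p\vee q)=o(n)$ as $n\to\infty$. **Conditions**, relative to a model $\mathcal M$ ($\mathcal P$ or $\mathcal P_G$). *$\ell_2$-consistency:* there are numbers $\mathrm{Err}_n$ with $|\mathrm{Err}_n|<1/(2B\sqrt r)$ such that, with probability $1-o(1)$ uniformly over $\mathbb P\in\mathcal M$, $$\max_{i\in[r]}\min_{w\in\{\pm1\}}(w\hat u_i-u_i)^T\Sigma_x(w\hat u_i-u_i)<\mathrm{Err}_n^2 .$$ *Type of $\widehat\Phi$:* (A) for some $C_{pre}\ge 1$, with probability $1-o(1)$ uniformly over $\mathbb P\in\mathcal P$, $\|\widehat\Phi-\Sigma_y^{-1}\|_{\infty,1}\le C_{pre}\,s(\Sigma_y^{-1})\sqrt{(\log q)/n}$; then $\xi_n=C_{pre}\sqrt{s(\Sigma_y^{-1})}$. (B) for some $C_{pre}\ge 1$, with probability $1-o(1)$ uniformly over $\mathbb P\in\mathcal P_G$, $\|\widehat\Phi-\Sigma_y^{-1}\|_{\infty,2}\le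 C_{pre}\sqrt{s(\Sigma_y^{-1})(\log q)/n}$; then $\xi_n=C_{pre}\max\{\sqrt{r(\log q)/n},1\}$. (C) $\widehat\Phi=\Sigma_y^{-1}$; then $\xi_n=1$. Let $\varepsilon_n=\xi_n\sqrt{\log(p+q)\,s(\Sigma_y^{-1})/n}$. **Theorem 1.** There is a constant $C'_B>0$, depending only on $B$ and, for types A and C, on the sub-Gaussian parameter $K$, such that the following holds. Let $\mathcal M=\mathcal P$ if $\widehat\Phi$ is of type A or C, and $\mathcal M=\mathcal P_G$ if $\widehat\Phi$ is of type B, and let $\widehat U$ satisfy the $\ell_2$-consistency condition over $\mathcal M$. Then, with probability $1-o(1)$ uniformly over all $\mathbb P\in\mathcal M$ with $\mathrm{Sig}_y>2C'_B\varepsilon_n$ and over all cut-offs $$\mathrm{cut}\in\Big[\frac{C'_B\varepsilon_n}{2B},\ \frac{(\theta_n-1)C'_B\varepsilon_n}{2B}\Big],\qquad \theta_n=\frac{\mathrm{Sig}_y}{C'_B\varepsilon_n},$$ RecoverSupp recovers the support exactly: $\widehat D(V)=D(V)$. -/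

import Mathlib

open MeasureTheory ProbabilityTheory Filter Topology Asymptotics
open scoped NNReal ENNReal Matrix

namespace SparseCCA

noncomputable section

/-! ### Matrices -/

/-- The support `D(A)` of a matrix: the set of indices of its nonzero rows. -/
def rowSupp {a b : ℕ} (A : Matrix (Fin a) (Fin b) ℝ) : Finset (Fin a) :=
  open Classical in Finset.univ.filter (fun k => ∃ j, A k j ≠ 0)

/-- `s(A)`: the maximal number of nonzero entries in a column of `A`. -/
def colSparsity {a b : ℕ} (A : Matrix (Fin a) (Fin b) ℝ) : ℕ :=
  open Classical in
  Finset.univ.sup (fun j : Fin b => (Finset.univ.filter (fun i : Fin a => A i j ≠ 0)).card)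

/-- `‖A‖_{∞,1}`: the maximum of the `ℓ₁`-norms of the rows of `A`. -/
def normInftyOne {a b : ℕ} (A : Matrix (Fin a) (Fin b) ℝ) : ℝ :=
  ⨆ i, ∑ j, |A i j|

/-- `‖A‖_{∞,2}`: the maximum of the `ℓ₂`-norms of the rows of `A`. -/
def normInftyTwo {a b : ℕ} (A : Matrix (Fin a) (Fin b) ℝ) : ℝ :=
  ⨆ i, √(∑ j, A i j ^ 2)

/-- The minimal signal strength of `V`: the minimum, over the nonzero rows of `V`, of the largest
absolute value of an entry in the row. -/
def signal {a b : ℕ} (V : Matrix (Fin a) (Fin b) ℝ) : ℝ :=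
  ⨅ k : {k : Fin a // k ∈ rowSupp V}, ⨆ i, |V k i|

/-! ### Canonical correlation analysis -/

/-- The feasible pairs `(u, v)` in the definition of the `j`-th pair of canonical directions:
`uᵀ Σ_x u = vᵀ Σ_y v = 1`, and `uᵀ Σ_x u_l = vᵀ Σ_y v_l = 0` for every earlier index `l`. -/
def ccaFeasible {p q r : ℕ} (Sx : Matrix (Fin p) (Fin p) ℝ) (Sy : Matrix (Fin q) (Fin q) ℝ)
    (U : Matrix (Fin p) (Fin r) ℝ) (V : Matrix (Fin q) (Fin r) ℝ) (j : Fin r) :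
    Set ((Fin p → ℝ) × (Fin q → ℝ)) :=
  {w | w.1 ⬝ᵥ Sx *ᵥ w.1 = 1 ∧ w.2 ⬝ᵥ Sy *ᵥ w.2 = 1 ∧
    ∀ l : Fin r, l < j → w.1 ⬝ᵥ Sx *ᵥ U.col l = 0 ∧ w.2 ⬝ᵥ Sy *ᵥ V.col l = 0}

/-- The columns of `U` and `V` are the first `r` pairs of canonical directions: recursively, the
`j`-th pair maximizes `uᵀ Σ_xy v` over the feasible pairs. -/
def IsCanonical {p q r : ℕ} (Sx : Matrix (Fin p) (Fin p) ℝ) (Sy : Matrix (Fin q) (Fin q) ℝ)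
    (Sxy : Matrix (Fin p) (Fin q) ℝ)
    (U : Matrix (Fin p) (Fin r) ℝ) (V : Matrix (Fin q) (Fin r) ℝ) : Prop :=
  ∀ j : Fin r, (U.col j, V.col j) ∈ ccaFeasible Sx Sy U V j ∧
    IsMaxOn (fun w : (Fin p → ℝ) × (Fin q → ℝ) => w.1 ⬝ᵥ Sxy *ᵥ w.2)
      (ccaFeasible Sx Sy U V j) (U.col j, V.col j)

/-- The canonical correlation `Λ_j = u_jᵀ Σ_xy v_j`. -/
def canonCorr {p q r : ℕ} (Sxy : Matrix (Fin p) (Fin q) ℝ)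
    (U : Matrix (Fin p) (Fin r) ℝ) (V : Matrix (Fin q) (Fin r) ℝ) (j : Fin r) : ℝ :=
  U.col j ⬝ᵥ Sxy *ᵥ V.col j

/-! ### Laws of one observation `(X, Y)` -/

/-- The space of one observation `(X, Y)`. -/
abbrev Obs (p q : ℕ) : Type := (Fin p → ℝ) × (Fin q → ℝ)

/-- The covariance matrix of `X`. -/
def covX {p q : ℕ} (μ : Measure (Obs p q)) : Matrix (Fin p) (Fin p) ℝ :=
  Matrix.of fun i j => cov[fun z => z.1 i, fun z => z.1 j; μ]

/-- The covariance matrix of `Y`. -/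
def covY {p q : ℕ} (μ : Measure (Obs p q)) : Matrix (Fin q) (Fin q) ℝ :=
  Matrix.of fun i j => cov[fun z => z.2 i, fun z => z.2 j; μ]

/-- The cross-covariance matrix of `X` and `Y`. -/
def covXY {p q : ℕ} (μ : Measure (Obs p q)) : Matrix (Fin p) (Fin q) ℝ :=
  Matrix.of fun i j => cov[fun z => z.1 i, fun z => z.2 j; μ]

/-- The parameters of the model: the dimensions `p` and `q`, the rank `r` of the cross-covariance
matrix, and the numbers `s_x` and `s_y` of nonzero rows of `U` and `V`. -/
structure Dims where
  p : ℕ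
  q : ℕ
  r : ℕ
  sx : ℕ
  sy : ℕ

/-- A model: which laws `μ` belong to it, together with the matrices `U` and `V` of their leading
canonical directions. -/
abbrev Model : Type :=
  (d : Dims) → Measure (Obs d.p d.q) →
    Matrix (Fin d.p) (Fin d.r) ℝ → Matrix (Fin d.q) (Fin d.r) ℝ → Prop

/-- The requirements, other than the one on the tails, on a law `μ` with leading canonical
directions `U` and `V`. -/
structure IsSparseCCA (B : ℝ) (d : Dims) (μ : Measure (Obs d.p d.q))
    (U : Matrix (Fin d.p) (Fin d.r) ℝ) (V : Matrix (Fin d.q) (Fin d.r) ℝ) : Prop where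
  isProbabilityMeasure : IsProbabilityMeasure μ
  meanX : ∀ i, ∫ z, z.1 i ∂μ = 0
  meanY : ∀ i, ∫ z, z.2 i ∂μ = 0
  rank : (covXY μ).rank = d.r
  canonical : IsCanonical (covX μ) (covY μ) (covXY μ) U V
  corr_ge : ∀ i, 1 / B ≤ canonCorr (covXY μ) U V i
  sparseU : (rowSupp U).card = d.sx
  sparseV : (rowSupp V).card = d.sy
  eigX : spectrum ℝ (covX μ) ⊆ Set.Ioo (1 / B) B
  eigY : spectrum ℝ (covY μ) ⊆ Set.Ioo (1 / B) B
  gap : ∀ i j : Fin d.r, (j : ℕ) = i + 1 →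
    1 / B ≤ canonCorr (covXY μ) U V i - canonCorr (covXY μ) U V j

/-- The sub-Gaussian model: in addition `X` and `Y` are (individually) sub-Gaussian random vectors,
every projection onto a unit vector having sub-Gaussian parameter (variance proxy) `K`. -/
def SubGaussianModel (B : ℝ) (K : ℝ≥0) : Model := fun d μ U V =>
  IsSparseCCA B d μ U V ∧
    (∀ u : Fin d.p → ℝ, u ⬝ᵥ u = 1 → HasSubgaussianMGF (fun z => u ⬝ᵥ z.1) K μ) ∧
    (∀ v : Fin d.q → ℝ, v ⬝ᵥ v = 1 → HasSubgaussianMGF (fun z => v ⬝ᵥ z.2) K μ)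

/-- The Gaussian model: in addition `(X, Y)` is jointly Gaussian. -/
def GaussianModel (B : ℝ) : Model := fun d μ U V =>
  IsSparseCCA B d μ U V ∧ IsGaussian μ

/-! ### Samples and the support recovery algorithm -/

/-- The first `⌊n/2⌋` of `n` observations. -/
def firstHalf {p q n : ℕ} (ω : Fin n → Obs p q) : Fin (n / 2) → Obs p q :=
  fun i => ω (Fin.castLE (Nat.div_le_self n 2) i)

/-- The empirical cross-covariance matrix of `X` and `Y` (which have mean zero) computed from the
observations with (one-based) numbers `⌊n/2⌋ + 1, …, n`. -/
def empCovXY {p q n : ℕ} (ω : Fin n → Obs p q) : Matrix (Fin p) (Fin q) ℝ :=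
  Matrix.of fun a b =>
    (∑ i ∈ Finset.univ.filter (fun i : Fin n => n / 2 ≤ (i : ℕ)), (ω i).1 a * (ω i).2 b) /
      ((n - n / 2 : ℕ) : ℝ)

/-- The support recovery algorithm: clean, `V_clean = Φ Σ_yx U`, then keep the indices of the rows
that have an entry of absolute value above the cut-off. -/
def recoverSupp {p q r : ℕ} (Uhat : Matrix (Fin p) (Fin r) ℝ) (Phi : Matrix (Fin q) (Fin q) ℝ)
    (Sxy : Matrix (Fin p) (Fin q) ℝ) (cut : ℝ) : Finset (Fin q) :=
  open Classical in Finset.univ.filter (fun k => ∃ j, cut < |(Phi * Sxyᵀ * Uhat) k j|)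

/-- An estimator of `U` for each `n`, computed from the `⌊n/2⌋` observations of the first half. -/
abbrev UEstimator (d : ℕ → Dims) : Type :=
  (n : ℕ) → (Fin (n / 2) → Obs (d n).p (d n).q) → Matrix (Fin (d n).p) (Fin (d n).r) ℝ

/-- An estimator of `Σ_y⁻¹` for each `n`, computed from the observations of the first half. -/
abbrev PrecisionEstimator (d : ℕ → Dims) : Type :=
  (n : ℕ) → (Fin (n / 2) → Obs (d n).p (d n).q) → Matrix (Fin (d n).q) (Fin (d n).q) ℝ

/-- The `ℓ₂`-consistency condition on the estimator of `U`: for some `err_n` with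
`|err_n| < 1 / (2 B √r)`, each column of the estimator is, up to its sign and in the norm of `Σ_x`,
at distance less than `err_n` from the column of `U`, with probability `1 - o(1)` uniformly over
the model. -/
def L2Consistent (B : ℝ) (d : ℕ → Dims) (M : Model) (Uhat : UEstimator d) : Prop :=
  ∃ err : ℕ → ℝ, (∀ n, |err n| < 1 / (2 * B * √((d n).r : ℝ))) ∧
    ∀ δ : ℝ≥0∞, 0 < δ → ∀ᶠ n in atTop, ∀ μ U V, M (d n) μ U V →
      Measure.pi (fun _ : Fin (n / 2) => μ)
        {ω | ∀ i, ∃ w : ℝ, (w = 1 ∨ w = -1) ∧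
          (w • (Uhat n ω).col i - U.col i) ⬝ᵥ covX μ *ᵥ (w • (Uhat n ω).col i - U.col i)
            < err n ^ 2}ᶜ ≤ δ

/-- The precision matrix estimator is of type A, with constant `Cpre`, over the model. -/
def TypeA (Cpre : ℝ) (d : ℕ → Dims) (M : Model) (Phi : PrecisionEstimator d) : Prop :=
  ∀ δ : ℝ≥0∞, 0 < δ → ∀ᶠ n in atTop, ∀ μ U V, M (d n) μ U V →
    Measure.pi (fun _ : Fin (n / 2) => μ)
      {ω | normInftyOne (Phi n ω - (covY μ)⁻¹) ≤
        Cpre * colSparsity (covY μ)⁻¹ * √(Real.log (d n).q / n)}ᶜ ≤ δ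

/-- The precision matrix estimator is of type B, with constant `Cpre`, over the model. -/
def TypeB (Cpre : ℝ) (d : ℕ → Dims) (M : Model) (Phi : PrecisionEstimator d) : Prop :=
  ∀ δ : ℝ≥0∞, 0 < δ → ∀ᶠ n in atTop, ∀ μ U V, M (d n) μ U V →
    Measure.pi (fun _ : Fin (n / 2) => μ)
      {ω | normInftyTwo (Phi n ω - (covY μ)⁻¹) ≤
        Cpre * √(colSparsity (covY μ)⁻¹ * Real.log (d n).q / n)}ᶜ ≤ δ

/-- `ξ_n` for type A. -/
def xiA (Cpre : ℝ) {p q : ℕ} (μ : Measure (Obs p q)) : ℝ :=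
  Cpre * √(colSparsity (covY μ)⁻¹ : ℝ)

/-- `ξ_n` for type B. -/
def xiB (Cpre : ℝ) (d : Dims) (n : ℕ) : ℝ :=
  Cpre * max √((d.r : ℝ) * Real.log d.q / n) 1

/-- `ε_n = ξ_n √(log(p+q) s(Σ_y⁻¹) / n)`. -/
def epsilon (ξ : ℝ) {p q : ℕ} (n : ℕ) (μ : Measure (Obs p q)) : ℝ :=
  ξ * √(Real.log ((p : ℝ) + q) * colSparsity (covY μ)⁻¹ / n)

/-- The conclusion: with probability `1 - o(1)`, uniformly over the laws of the model whose minimal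
signal exceeds `2 C' ε_n` and over the cut-offs in the window
`[C' ε_n / (2B), (θ_n - 1) C' ε_n / (2B)]`, `θ_n = Sig_y / (C' ε_n)`, the algorithm recovers `D(V)`.
Here `Phi` is the (estimated or true) precision matrix, and may refer to the law `μ`. -/
def RecoversSupport (B C' : ℝ) (d : ℕ → Dims) (M : Model) (Uhat : UEstimator d)
    (Phi : (n : ℕ) → Measure (Obs (d n).p (d n).q) →
      (Fin (n / 2) → Obs (d n).p (d n).q) → Matrix (Fin (d n).q) (Fin (d n).q) ℝ)
    (ξ : (n : ℕ) → Measure (Obs (d n).p (d n).q) → ℝ) : Prop :=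
  ∀ δ : ℝ≥0∞, 0 < δ → ∀ᶠ n in atTop, ∀ μ U V, M (d n) μ U V →
    2 * C' * epsilon (ξ n μ) n μ < signal V →
    ∀ cut ∈ Set.Icc (C' * epsilon (ξ n μ) n μ / (2 * B))
        ((signal V / (C' * epsilon (ξ n μ) n μ) - 1) * (C' * epsilon (ξ n μ) n μ) / (2 * B)),
      Measure.pi (fun _ : Fin n => μ)
        {ω | recoverSupp (Uhat n (firstHalf ω)) (Phi n μ (firstHalf ω)) (empCovXY ω) cut
          = rowSupp V}ᶜ ≤ δ

/-- The asymptotic regime: the rank is positive, the dimension grows, and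
`log (max p q) = o(n)`. -/
structure HighDim (d : ℕ → Dims) : Prop where
  rank_pos : ∀ n, 1 ≤ (d n).r
  dim_tendsto : Tendsto (fun n => (d n).p + (d n).q) atTop atTop
  log_isLittleO : (fun n => Real.log ((max (d n).p (d n).q : ℕ) : ℝ)) =o[atTop]
    (fun n => (n : ℝ))

end

end SparseCCA

/-!
Write `Φ = Σ_y⁻¹`, and `ũ_j` for the `j`-th column of the estimator of `U` with its sign chosen as in
the consistency condition. The proof compares the cleaned matrix `Φ̂ Σ̂_yx Û` with its noiseless
version `Φ Σ_yx Û`.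

*The noiseless matrix.* The maximizers in the definition of the canonical pairs satisfy the
first-order conditions `Σ_yx u_j = Λ_j Σ_y v_j` and `Σ_xy v_j = Λ_j Σ_x u_j`, and since `Σ_xy` has
rank `r` this gives `Σ_yx = Σ_y V Λ Uᵀ Σ_x` (`IsCanonical.transpose_mulVec`). Hence the `k`-th row of
`Φ Σ_yx Û` vanishes for `k ∉ D(V)`. For `k ∈ D(V)`, the entry at the index `j` that maximizes
`Λ_j |V_kj|` exceeds `Sig_y / (2B)`: up to sign it is `Λ_j V_kj + ∑ l, Λ_l V_kl e_l` with
`e_l = u_lᵀ Σ_x (ũ_j - u_j)`, and `∑ l, |e_l| ≤ √r |err| < 1 / (2B)` by Bessel and Cauchy–Schwarz.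
So thresholding is exact when every entry of the noise is at most `C' ε_n / (2B)`
(`recoverSupp_eq_rowSupp`).

*The noise.* In row `k` and column `j`, up to sign, it is
`(Φ̂ - Φ)_k Σ_yx ũ_j + (Φ̂ - Φ)_k (Σ̂_yx - Σ_yx) ũ_j + Φ_k (Σ̂_yx - Σ_yx) ũ_j`.
For each type of estimator the rows of `Φ̂ - Φ` have Euclidean norm at most `ε_n` (for type A because
the `ℓ₂` norm is at most the `ℓ₁` norm), and `ũ_j` and `Φ_k` are bounded in terms of `B`. Given the
first half of the sample, the last two terms are centred averages of products of two sub-Gaussian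
variables. Such products are sub-exponential, so Bernstein's inequality
(`measure_abs_sum_mul_ge_le`) and a union bound over the `q r` entries give deviations of order
`√(log (p + q) / n) ≤ ε_n` with probability `1 - O(1 / (p + q))`; see `measure_recoverSupp_ne_le`.

The Gaussian model lies inside the sub-Gaussian model with parameter `B`, so that
`recoversSupport_of_row_error` covers all three types.
-/

namespace SparseCCA

/-! ### Quadratic forms -/

section BilinForm

variable {E ι : Type*} [AddCommGroup E] [Module ℝ E] (β : LinearMap.BilinForm ℝ E)

/-- First-order condition: if `v` maximizes the linear functional `g` over the unit vectors of `P` for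
the form `β`, then `g` vanishes on the vectors of `P` orthogonal to `v`. -/
lemma eq_zero_of_isMax_normalized (hβ : ∀ x, 0 ≤ β x x) (hsymm : ∀ x y, β x y = β y x)
    (g : E →ₗ[ℝ] ℝ) (P : Submodule ℝ E) {v : E} (hvP : v ∈ P) (hv : β v v = 1) (hg : 0 ≤ g v)
    (hmax : ∀ w ∈ P, β w w = 1 → g w ≤ g v) {w : E} (hw : w ∈ P) (hwv : β w v = 0) : g w = 0 := by
  set N := β w w
  have hN : 0 ≤ N := hβ w
  -- Compare `v` with the normalization of `v + t • w`, whose squared length is `1 + t² N`.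
  have key : ∀ t : ℝ, t * g w ≤ g v * (t ^ 2 * N / 2) := by
    intro t
    have hpos : 0 < 1 + t ^ 2 * N := by positivity
    have hs : 0 < √(1 + t ^ 2 * N) := Real.sqrt_pos.2 hpos
    have hq : β (v + t • w) (v + t • w) = 1 + t ^ 2 * N := by
      simp only [map_add, map_smul, LinearMap.add_apply, LinearMap.smul_apply, smul_eq_mul, hv,
        hsymm v w, hwv]
      ring
    have h := hmax ((√(1 + t ^ 2 * N))⁻¹ • (v + t • w))
      (P.smul_mem _ (P.add_mem hvP (P.smul_mem _ hw))) (by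
        simp only [map_smul, LinearMap.smul_apply, smul_eq_mul, hq]
        rw [← mul_assoc, ← mul_inv, Real.mul_self_sqrt hpos.le, inv_mul_cancel₀ hpos.ne'])
    simp only [map_smul, map_add, smul_eq_mul] at h
    rw [inv_mul_le_iff₀ hs] at h
    have h2 : √(1 + t ^ 2 * N) ≤ 1 + t ^ 2 * N / 2 := by
      rw [Real.sqrt_le_left (by positivity)]
      nlinarith [sq_nonneg (t ^ 2 * N)]
    nlinarith [mul_le_mul_of_nonneg_right h2 hg]
  by_contra hne
  have hc : 0 < (g w) ^ 2 := by positivity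
  have hD : 0 < g v * N + 1 := by positivity
  have h := key (g w / (g v * N + 1))
  have h3 : g w / (g v * N + 1) * g w * (g v * N + 1) ^ 2
      ≤ g v * ((g w / (g v * N + 1)) ^ 2 * N / 2) * (g v * N + 1) ^ 2 := by gcongr
  have e1 : g w / (g v * N + 1) * g w * (g v * N + 1) ^ 2 = (g w) ^ 2 * (g v * N + 1) := by
    field_simp
  have e2 : g v * ((g w / (g v * N + 1)) ^ 2 * N / 2) * (g v * N + 1) ^ 2
      = (g w) ^ 2 * (g v * N / 2) := by
    field_simp
  rw [e1, e2] at h3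
  have := le_of_mul_le_mul_left h3 hc
  have : 0 ≤ g v * N := by positivity
  linarith

/-- A functional that vanishes on the earlier vectors of an orthonormal family, and is maximized by
`v j` among the unit vectors orthogonal to them, is represented by a multiple of `v j`. -/
lemma eq_smul_of_isMax_normalized [LinearOrder ι] [LocallyFiniteOrderBot ι]
    (hβ : ∀ x, 0 ≤ β x x) (hsymm : ∀ x y, β x y = β y x)
    (g : E →ₗ[ℝ] ℝ) (v : ι → E) (hv : ∀ l, β (v l) (v l) = 1)
    (hvv : ∀ l m, l < m → β (v m) (v l) = 0)
    (j : ι) (hgl : ∀ l < j, g (v l) = 0) (hg : 0 ≤ g (v j))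
    (hmax : ∀ w, (∀ l < j, β w (v l) = 0) → β w w = 1 → g w ≤ g (v j)) (w : E) :
    g w = g (v j) * β w (v j) := by
  classical
  have horth : ∀ l m, β (v l) (v m) = if l = m then 1 else 0 := by
    intro l m
    rcases lt_trichotomy l m with h | h | h
    · rw [hsymm, hvv _ _ h, if_neg h.ne]
    · rw [h, hv, if_pos rfl]
    · rw [hvv _ _ h, if_neg h.ne']
  set w0 := w - ∑ l ∈ Finset.Iic j, β w (v l) • v l with hw0
  have hw0' : ∀ m ≤ j, β w0 (v m) = 0 := by
    intro m hm
    simp only [hw0, map_sub, map_sum, map_smul, LinearMap.sub_apply, LinearMap.sum_apply,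
      LinearMap.smul_apply, smul_eq_mul, horth]
    simp [hm]
  let P : Submodule ℝ E := ⨅ l : {l // l < j}, LinearMap.ker (β.flip (v l))
  have hP : ∀ x, x ∈ P ↔ ∀ l < j, β x (v l) = 0 := by
    intro x
    simp [P, Submodule.mem_iInf]
  have h0 : g w0 = 0 := by
    refine eq_zero_of_isMax_normalized β hβ hsymm g P (v := v j) ?_ (hv j) hg ?_ ?_ ?_
    · exact (hP _).2 fun l hl => hvv _ _ hl
    · exact fun w hw => hmax w ((hP _).1 hw)
    · exact (hP _).2 fun l hl => hw0' l hl.le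
    · exact hw0' j le_rfl
  have : g w = ∑ l ∈ Finset.Iic j, β w (v l) * g (v l) := by
    have := h0
    simp only [hw0, map_sub, map_sum, map_smul, smul_eq_mul] at this
    linarith
  rw [this, Finset.sum_eq_single j, mul_comm]
  · intro l hl hlj
    rw [hgl l (lt_of_le_of_ne (Finset.mem_Iic.1 hl) hlj), mul_zero]
  · simp

/-- Bessel's inequality for a positive semidefinite form. -/
lemma sum_sq_le_of_orthonormal [Fintype ι] [DecidableEq ι]
    (hβ : ∀ x, 0 ≤ β x x) (hsymm : ∀ x y, β x y = β y x)
    (v : ι → E) (hv : ∀ l m, β (v l) (v m) = if l = m then 1 else 0) (x : E) :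
    ∑ l, β (v l) x ^ 2 ≤ β x x := by
  have h := hβ (x - ∑ l, β (v l) x • v l)
  simp only [map_sub, map_sum, map_smul, LinearMap.sub_apply, LinearMap.sum_apply,
      LinearMap.smul_apply, smul_eq_mul, hv, hsymm x] at h
  simp at h
  simp only [pow_two]
  linarith

end BilinForm

section Spectrum

variable {n : Type*} [Fintype n] [DecidableEq n] {A : Matrix n n ℝ} {c : ℝ}

lemma le_quadForm_of_spectrum (hA : A.IsHermitian) (h : ∀ x ∈ spectrum ℝ A, c ≤ x) (w : n → ℝ) :
    c * (w ⬝ᵥ w) ≤ w ⬝ᵥ A *ᵥ w := by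
  have hps : (A - algebraMap ℝ (Matrix n n ℝ) c).PosSemidef := by
    rw [Matrix.posSemidef_iff_isHermitian_and_spectrum_nonneg]
    refine ⟨hA.sub ?_, ?_⟩
    · rw [Algebra.algebraMap_eq_smul_one, Matrix.IsHermitian]; simp
    · rw [← spectrum.sub_singleton_eq]
      rintro _ ⟨x, hx, _, rfl, rfl⟩
      simpa using h x hx
  have := hps.dotProduct_mulVec_nonneg w
  simp only [star_trivial, Matrix.sub_mulVec, dotProduct_sub, Algebra.algebraMap_eq_smul_one,
    Matrix.smul_mulVec, Matrix.one_mulVec, dotProduct_smul, smul_eq_mul] at this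
  linarith

lemma quadForm_le_of_spectrum (hA : A.IsHermitian) (h : ∀ x ∈ spectrum ℝ A, x ≤ c) (w : n → ℝ) :
    w ⬝ᵥ A *ᵥ w ≤ c * (w ⬝ᵥ w) := by
  have := le_quadForm_of_spectrum (A := -A) (c := -c) hA.neg (by
    intro x hx
    rw [← spectrum.neg_eq] at hx
    have := h _ (Set.mem_neg.1 hx)
    linarith) w
  rw [Matrix.neg_mulVec, dotProduct_neg] at this
  linarith

lemma isUnit_det_of_quadForm (hc : 0 < c) (h : ∀ w, c * (w ⬝ᵥ w) ≤ w ⬝ᵥ A *ᵥ w) :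
    IsUnit A.det := by
  rw [← Matrix.isUnit_iff_isUnit_det, ← Matrix.mulVec_injective_iff_isUnit]
  refine (injective_iff_map_eq_zero (Matrix.mulVecLin A)).2 fun w hw => ?_
  have h1 := h w
  rw [show A *ᵥ w = 0 from hw, dotProduct_zero] at h1
  have h2 : w ⬝ᵥ w = 0 := le_antisymm (by nlinarith) (by
    rw [dotProduct]; exact Finset.sum_nonneg fun i _ => mul_self_nonneg _)
  exact dotProduct_self_eq_zero.1 h2

/-- The rows of the inverse of a matrix `A ≥ c` have Euclidean norm at most `1 / c`. -/
lemma sum_inv_row_sq_le (hc : 0 < c) (hA : A.IsHermitian)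
    (h : ∀ w, c * (w ⬝ᵥ w) ≤ w ⬝ᵥ A *ᵥ w) (k : n) : A⁻¹ k ⬝ᵥ A⁻¹ k ≤ (1 / c) ^ 2 := by
  have hu := isUnit_det_of_quadForm hc h
  have hsymm : A⁻¹ᵀ = A⁻¹ := by
    have := hA.inv
    simpa [Matrix.IsHermitian] using this
  set w := A⁻¹ k
  have hAw : A *ᵥ w = Pi.single k 1 := by
    have : w = A⁻¹ *ᵥ Pi.single k 1 := by
      rw [Matrix.mulVec_single_one]
      ext i
      exact (congrFun (congrFun hsymm k) i).symm
    rw [this, Matrix.mulVec_mulVec, Matrix.mul_nonsing_inv _ hu, Matrix.one_mulVec]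
  have h1 := h w
  rw [hAw, dotProduct_single_one] at h1
  have h2 : w k ^ 2 ≤ w ⬝ᵥ w := by
    rw [dotProduct, pow_two]
    exact Finset.single_le_sum (f := fun i => w i * w i) (fun i _ => mul_self_nonneg _)
      (Finset.mem_univ k)
  set s := w ⬝ᵥ w
  have hs : 0 ≤ s := (sq_nonneg _).trans h2
  have h3 : (c * s) ^ 2 ≤ s := by
    have : 0 ≤ c * s := by positivity
    nlinarith
  rw [div_pow, one_pow, le_div_iff₀ (by positivity)]
  by_contra hcon
  push Not at hcon
  nlinarith

end Spectrum

/-! ### Canonical directions and thresholding -/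

section Canonical

variable {p q r : ℕ} {Sx : Matrix (Fin p) (Fin p) ℝ} {Sy : Matrix (Fin q) (Fin q) ℝ}
  {Sxy : Matrix (Fin p) (Fin q) ℝ} {U : Matrix (Fin p) (Fin r) ℝ} {V : Matrix (Fin q) (Fin r) ℝ}

lemma dotProduct_mulVec_comm {n : Type*} [Fintype n] {A : Matrix n n ℝ} (hA : A.IsHermitian)
    (x y : n → ℝ) : x ⬝ᵥ A *ᵥ y = y ⬝ᵥ A *ᵥ x := by
  have h : Aᵀ = A := by simpa [Matrix.IsHermitian] using hA
  rw [Matrix.dotProduct_mulVec, ← Matrix.mulVec_transpose, h, dotProduct_comm]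

lemma IsCanonical.orthonormal_left (h : IsCanonical Sx Sy Sxy U V) (hSx : Sx.IsHermitian)
    (l m : Fin r) : U.col l ⬝ᵥ Sx *ᵥ U.col m = if l = m then 1 else 0 := by
  rcases lt_trichotomy l m with hlm | rfl | hlm
  · rw [dotProduct_mulVec_comm hSx, ((h m).1.2.2 l hlm).1, if_neg hlm.ne]
  · rw [(h l).1.1, if_pos rfl]
  · rw [((h l).1.2.2 m hlm).1, if_neg hlm.ne']

lemma IsCanonical.orthonormal_right (h : IsCanonical Sx Sy Sxy U V) (hSy : Sy.IsHermitian)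
    (l m : Fin r) : V.col l ⬝ᵥ Sy *ᵥ V.col m = if l = m then 1 else 0 := by
  rcases lt_trichotomy l m with hlm | rfl | hlm
  · rw [dotProduct_mulVec_comm hSy, ((h m).1.2.2 l hlm).2, if_neg hlm.ne]
  · rw [(h l).1.2.1, if_pos rfl]
  · rw [((h l).1.2.2 m hlm).2, if_neg hlm.ne']

/-- The first-order conditions for the canonical pairs. The induction supplies
`u_jᵀ Σ_xy v_l = Λ_l u_jᵀ Σ_x u_l = 0` for the earlier indices `l`. -/
lemma IsCanonical.mulVec_eq (h : IsCanonical Sx Sy Sxy U V) (hSx : Sx.IsHermitian)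
    (hSy : Sy.IsHermitian) (hx : ∀ w, 0 ≤ w ⬝ᵥ Sx *ᵥ w) (hy : ∀ w, 0 ≤ w ⬝ᵥ Sy *ᵥ w)
    (hpos : ∀ j, 0 ≤ canonCorr Sxy U V j) (j : Fin r) :
    Sxyᵀ *ᵥ U.col j = canonCorr Sxy U V j • Sy *ᵥ V.col j ∧
      Sxy *ᵥ V.col j = canonCorr Sxy U V j • Sx *ᵥ U.col j := by
  induction j using WellFoundedLT.induction with
  | _ j ih =>
  have hT : ∀ (x : Fin p → ℝ) (y : Fin q → ℝ), Sxyᵀ *ᵥ x ⬝ᵥ y = x ⬝ᵥ Sxy *ᵥ y := by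
    intro x y
    rw [Matrix.mulVec_transpose, Matrix.dotProduct_mulVec]
  constructor
  · refine dotProduct_eq _ _ fun w => ?_
    have := eq_smul_of_isMax_normalized (Matrix.toBilin' Sy)
      (by intro x; rw [Matrix.toBilin'_apply']; exact hy x)
      (by intro x y; rw [Matrix.toBilin'_apply', Matrix.toBilin'_apply',
            dotProduct_mulVec_comm hSy])
      (dotProductBilin ℝ ℝ (Sxyᵀ *ᵥ U.col j)) (fun l => V.col l)
      (by intro l; rw [Matrix.toBilin'_apply']; exact (h l).1.2.1)
      (by intro l m hlm; rw [Matrix.toBilin'_apply']; exact ((h m).1.2.2 l hlm).2)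
      j
      (by
        intro l hl
        change Sxyᵀ *ᵥ U.col j ⬝ᵥ V.col l = 0
        rw [hT, (ih l hl).2, dotProduct_smul, ((h j).1.2.2 l hl).1, smul_zero])
      (by
        change 0 ≤ Sxyᵀ *ᵥ U.col j ⬝ᵥ V.col j
        rw [hT]; exact hpos j)
      (by
        intro w hw1 hw2
        change Sxyᵀ *ᵥ U.col j ⬝ᵥ w ≤ Sxyᵀ *ᵥ U.col j ⬝ᵥ V.col j
        rw [hT, hT]
        simp only [Matrix.toBilin'_apply'] at hw1 hw2
        exact isMaxOn_iff.1 (h j).2 (U.col j, w)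
          ⟨(h j).1.1, hw2, fun l hl => ⟨((h j).1.2.2 l hl).1, hw1 l hl⟩⟩)
      w
    change Sxyᵀ *ᵥ U.col j ⬝ᵥ w = (Sxyᵀ *ᵥ U.col j ⬝ᵥ V.col j) * _ at this
    rw [this, hT, Matrix.toBilin'_apply', smul_dotProduct, smul_eq_mul, dotProduct_comm w]
    rfl
  · refine dotProduct_eq _ _ fun w => ?_
    have := eq_smul_of_isMax_normalized (Matrix.toBilin' Sx)
      (by intro x; rw [Matrix.toBilin'_apply']; exact hx x)
      (by intro x y; rw [Matrix.toBilin'_apply', Matrix.toBilin'_apply',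
            dotProduct_mulVec_comm hSx])
      (dotProductBilin ℝ ℝ (Sxy *ᵥ V.col j)) (fun l => U.col l)
      (by intro l; rw [Matrix.toBilin'_apply']; exact (h l).1.1)
      (by intro l m hlm; rw [Matrix.toBilin'_apply']; exact ((h m).1.2.2 l hlm).1)
      j
      (by
        intro l hl
        change Sxy *ᵥ V.col j ⬝ᵥ U.col l = 0
        rw [dotProduct_comm, ← hT, (ih l hl).1, smul_dotProduct, dotProduct_comm,
          ((h j).1.2.2 l hl).2, smul_zero])
      (by
        change 0 ≤ Sxy *ᵥ V.col j ⬝ᵥ U.col j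
        rw [dotProduct_comm]; exact hpos j)
      (by
        intro w hw1 hw2
        change Sxy *ᵥ V.col j ⬝ᵥ w ≤ Sxy *ᵥ V.col j ⬝ᵥ U.col j
        rw [dotProduct_comm, dotProduct_comm _ (U.col j)]
        simp only [Matrix.toBilin'_apply'] at hw1 hw2
        exact isMaxOn_iff.1 (h j).2 (w, V.col j)
          ⟨hw2, (h j).1.2.1, fun l hl => ⟨hw1 l hl, ((h j).1.2.2 l hl).2⟩⟩)
      w
    change Sxy *ᵥ V.col j ⬝ᵥ w = (Sxy *ᵥ V.col j ⬝ᵥ U.col j) * _ at this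
    rw [this, Matrix.toBilin'_apply', smul_dotProduct, smul_eq_mul, dotProduct_comm w,
      dotProduct_comm _ (U.col j)]
    rfl

/-- The canonical decomposition `Σ_yx = Σ_y V Λ Uᵀ Σ_x`, applied to a vector. The rank hypothesis
makes the images of the `r` canonical directions span the whole range. -/
lemma IsCanonical.transpose_mulVec (h : IsCanonical Sx Sy Sxy U V) (hSx : Sx.IsHermitian)
    (hSy : Sy.IsHermitian) (hx : ∀ w, 0 ≤ w ⬝ᵥ Sx *ᵥ w) (hy : ∀ w, 0 ≤ w ⬝ᵥ Sy *ᵥ w)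
    (hrank : Sxy.rank = r) (hpos : ∀ j, 0 < canonCorr Sxy U V j) (x : Fin p → ℝ) :
    Sxyᵀ *ᵥ x =
      ∑ l, (canonCorr Sxy U V l * (U.col l ⬝ᵥ Sx *ᵥ x)) • Sy *ᵥ V.col l := by
  have heq := h.mulVec_eq hSx hSy hx hy (fun j => (hpos j).le)
  have hcoef : ∀ (c : Fin r → ℝ) m, V.col m ⬝ᵥ ∑ l, c l • Sy *ᵥ V.col l = c m := by
    intro c m
    simp [dotProduct_sum, h.orthonormal_right hSy]
  have hli : LinearIndependent ℝ (fun l => Sy *ᵥ V.col l) := by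
    rw [Fintype.linearIndependent_iff]
    intro c hc m
    rw [← hcoef c m, hc, dotProduct_zero]
  have hspan : Submodule.span ℝ (Set.range fun l => Sy *ᵥ V.col l)
      = LinearMap.range Sxyᵀ.mulVecLin := by
    refine Submodule.eq_of_le_of_finrank_eq ?_ ?_
    · rw [Submodule.span_le]
      rintro _ ⟨l, rfl⟩
      refine ⟨(canonCorr Sxy U V l)⁻¹ • U.col l, ?_⟩
      rw [Matrix.mulVecLin_apply, Matrix.mulVec_smul, (heq l).1, smul_smul,
        inv_mul_cancel₀ (hpos l).ne', one_smul]
    · rw [finrank_span_eq_card hli, Fintype.card_fin]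
      have : Sxyᵀ.rank = r := by rw [Matrix.rank_transpose, hrank]
      exact this.symm
  have hmem : Sxyᵀ *ᵥ x ∈ Submodule.span ℝ (Set.range fun l => Sy *ᵥ V.col l) := by
    rw [hspan]; exact ⟨x, rfl⟩
  obtain ⟨c, hc⟩ := (Submodule.mem_span_range_iff_exists_fun ℝ).1 hmem
  rw [← hc]
  refine Finset.sum_congr rfl fun m _ => ?_
  congr 1
  rw [← hcoef c m, hc, dotProduct_comm, Matrix.mulVec_transpose, ← Matrix.dotProduct_mulVec,
    (heq m).2, dotProduct_smul, smul_eq_mul, dotProduct_mulVec_comm hSx]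

lemma IsCanonical.precision_mul_apply (h : IsCanonical Sx Sy Sxy U V) (hSx : Sx.IsHermitian)
    (hSy : Sy.IsHermitian) (hx : ∀ w, 0 ≤ w ⬝ᵥ Sx *ᵥ w) (hy : ∀ w, 0 ≤ w ⬝ᵥ Sy *ᵥ w)
    (hu : IsUnit Sy.det) (hrank : Sxy.rank = r) (hpos : ∀ j, 0 < canonCorr Sxy U V j)
    {m : ℕ} (W : Matrix (Fin p) (Fin m) ℝ) (k : Fin q) (j : Fin m) :
    (Sy⁻¹ * Sxyᵀ * W) k j =
      ∑ l, canonCorr Sxy U V l * V k l * (U.col l ⬝ᵥ Sx *ᵥ W.col j) := by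
  have e : (Sy⁻¹ * Sxyᵀ * W) k j = (Sy⁻¹ *ᵥ (Sxyᵀ *ᵥ W.col j)) k := by
    rw [Matrix.mulVec_mulVec]; rfl
  rw [e, h.transpose_mulVec hSx hSy hx hy hrank hpos, Matrix.mulVec_sum, Finset.sum_apply]
  refine Finset.sum_congr rfl fun l _ => ?_
  rw [Matrix.mulVec_smul, Matrix.mulVec_mulVec, Matrix.nonsing_inv_mul _ hu, Matrix.one_mulVec,
    Pi.smul_apply, smul_eq_mul, Matrix.col_apply]
  ring

/-- The deterministic part of support recovery: it succeeds as soon as the entries of the cleaned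
matrix are within `η` of their noiseless values, where `η` is below the cut-off and leaves room
between the cut-off and half the weakest signal. -/
lemma recoverSupp_eq_rowSupp {B η cut : ℝ} (hB : 1 < B)
    (h : IsCanonical Sx Sy Sxy U V) (hSx : Sx.IsHermitian)
    (hSy : Sy.IsHermitian) (hx : ∀ w, 0 ≤ w ⬝ᵥ Sx *ᵥ w) (hy : ∀ w, 0 ≤ w ⬝ᵥ Sy *ᵥ w)
    (hu : IsUnit Sy.det) (hrank : Sxy.rank = r) (hcorr : ∀ j, 1 / B ≤ canonCorr Sxy U V j)
    (hr : 1 ≤ r) {Uhat : Matrix (Fin p) (Fin r) ℝ} {err : ℝ}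
    (herr : |err| < 1 / (2 * B * √(r : ℝ)))
    (hU : ∀ i, ∃ w : ℝ, (w = 1 ∨ w = -1) ∧
      (w • Uhat.col i - U.col i) ⬝ᵥ Sx *ᵥ (w • Uhat.col i - U.col i) < err ^ 2)
    {Phi : Matrix (Fin q) (Fin q) ℝ} {Shat : Matrix (Fin p) (Fin q) ℝ}
    (hnoise : ∀ k j, |(Phi * Shatᵀ * Uhat) k j - (Sy⁻¹ * Sxyᵀ * Uhat) k j| ≤ η)
    (hcut : η ≤ cut) (hsig : cut + η ≤ signal V / (2 * B)) :
    recoverSupp Uhat Phi Shat cut = rowSupp V := by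
  have hB0 : 0 < B := by linarith
  have hpos : ∀ j, 0 < canonCorr Sxy U V j := fun j => lt_of_lt_of_le (by positivity) (hcorr j)
  have hT := fun k j => h.precision_mul_apply hSx hSy hx hy hu hrank hpos Uhat k j
  ext k
  simp only [recoverSupp, rowSupp, Finset.mem_filter, Finset.mem_univ, true_and]
  constructor
  · rintro ⟨j, hj⟩
    by_contra hk
    push Not at hk
    have h0 : (Sy⁻¹ * Sxyᵀ * Uhat) k j = 0 := by
      rw [hT]
      exact Finset.sum_eq_zero fun l _ => by rw [hk l]; ring
    have := hnoise k j
    rw [h0, sub_zero] at this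
    linarith
  · intro hk
    have : Nonempty (Fin r) := ⟨⟨0, hr⟩⟩
    set x : Fin r → ℝ := fun l => canonCorr Sxy U V l * V k l with hxdef
    -- The largest entry of the row of `V Λ` dominates the errors coming from the other entries.
    obtain ⟨j, hj⟩ := Finite.exists_max fun l => |x l|
    have hbdd : BddAbove (Set.range fun l => |V k l|) := Set.finite_range _ |>.bddAbove
    have hxj : (⨆ i, |V k i|) / B ≤ |x j| := by
      rw [div_le_iff₀ hB0]
      refine ciSup_le fun l => ?_
      refine le_trans ?_ (mul_le_mul_of_nonneg_right (hj l) hB0.le)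
      rw [hxdef, abs_mul, abs_of_pos (hpos l)]
      have h1 : 1 ≤ canonCorr Sxy U V l * B := by
        have := hcorr l
        rwa [div_le_iff₀ hB0] at this
      nlinarith [abs_nonneg (V k l)]
    have hsig' : signal V ≤ ⨆ i, |V k i| := by
      refine ciInf_le (f := fun k : {k : Fin q // k ∈ rowSupp V} => ⨆ i, |V k i|)
        (Set.finite_range _).bddBelow ⟨k, ?_⟩
      simpa [rowSupp] using hk
    have hxpos : 0 < |x j| := by
      obtain ⟨l, hl⟩ := hk
      exact lt_of_lt_of_le (abs_pos.2 (mul_ne_zero (hpos l).ne' hl)) (hj l)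
    obtain ⟨w, hw, hwU⟩ := hU j
    set e : Fin r → ℝ := fun l => U.col l ⬝ᵥ Sx *ᵥ (w • Uhat.col j - U.col j) with hedef
    have hw1 : |w| = 1 := by rcases hw with rfl | rfl <;> simp
    have hwT : w * (Sy⁻¹ * Sxyᵀ * Uhat) k j = x j + ∑ l, x l * e l := by
      have : ∀ l, x l * e l = w * (x l * (U.col l ⬝ᵥ Sx *ᵥ Uhat.col j))
          - x l * (if l = j then 1 else 0) := by
        intro l
        simp only [hedef, Matrix.mulVec_sub, dotProduct_sub, Matrix.mulVec_smul, dotProduct_smul,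
          smul_eq_mul, h.orthonormal_left hSx]
        ring
      rw [hT]
      simp only [this, Finset.sum_sub_distrib, ← Finset.mul_sum]
      simp [hxdef]
    have hbess : ∑ l, e l ^ 2 < err ^ 2 := by
      refine lt_of_le_of_lt ?_ hwU
      have := sum_sq_le_of_orthonormal (Matrix.toBilin' Sx)
        (by intro x; rw [Matrix.toBilin'_apply']; exact hx x)
        (by intro x y; rw [Matrix.toBilin'_apply', Matrix.toBilin'_apply',
            dotProduct_mulVec_comm hSx])
        (fun l => U.col l)
        (by intro l m; rw [Matrix.toBilin'_apply']; exact h.orthonormal_left hSx l m)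
        (w • Uhat.col j - U.col j)
      simpa only [Matrix.toBilin'_apply'] using this
    have hr0 : (0 : ℝ) < r := by exact_mod_cast hr
    have hsum : ∑ l, |e l| ≤ 1 / (2 * B) := by
      have hcs : (∑ l, |e l|) ^ 2 ≤ r * ∑ l, e l ^ 2 := by
        have := sq_sum_le_card_mul_sum_sq (s := Finset.univ) (f := fun l => |e l|)
        simpa using this
      have herr2 : err ^ 2 ≤ (1 / (2 * B * √(r : ℝ))) ^ 2 := by
        rw [← sq_abs err]; gcongr
      have : (∑ l, |e l|) ^ 2 ≤ (1 / (2 * B)) ^ 2 := by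
        refine hcs.trans ((mul_le_mul_of_nonneg_left (hbess.le.trans herr2) hr0.le).trans
          (le_of_eq ?_))
        rw [div_pow, mul_pow, Real.sq_sqrt hr0.le]
        field_simp
      exact abs_le_of_sq_le_sq' this (by positivity) |>.2
    have herrsum : |∑ l, x l * e l| ≤ |x j| * (1 / (2 * B)) := by
      refine (Finset.abs_sum_le_sum_abs _ _).trans ?_
      refine le_trans ?_ (mul_le_mul_of_nonneg_left hsum (abs_nonneg _))
      rw [Finset.mul_sum]
      refine Finset.sum_le_sum fun l _ => ?_
      rw [abs_mul]
      exact mul_le_mul_of_nonneg_right (hj l) (abs_nonneg _)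
    have hlow : |x j| / 2 < |(Sy⁻¹ * Sxyᵀ * Uhat) k j| := by
      have h1 : |(Sy⁻¹ * Sxyᵀ * Uhat) k j| = |x j + ∑ l, x l * e l| := by
        rw [← hwT, abs_mul, hw1, one_mul]
      have h2 : |x j| - |∑ l, x l * e l| ≤ |x j + ∑ l, x l * e l| := by
        have := abs_sub_abs_le_abs_sub (x j) (-∑ l, x l * e l)
        rwa [abs_neg, sub_neg_eq_add] at this
      have h3 : 1 / (2 * B) < 1 / 2 := by
        apply one_div_lt_one_div_of_lt <;> linarith
      rw [h1]
      nlinarith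
    refine ⟨j, ?_⟩
    have h4 := hnoise k j
    have h5 : signal V / (2 * B) ≤ |x j| / 2 := by
      have : signal V / B ≤ |x j| := (by gcongr : signal V / B ≤ _).trans hxj
      rw [show signal V / (2 * B) = signal V / B / 2 by field_simp]
      linarith
    have h6 := abs_sub_abs_le_abs_sub ((Sy⁻¹ * Sxyᵀ * Uhat) k j) ((Phi * Shatᵀ * Uhat) k j)
    rw [abs_sub_comm] at h6
    linarith

end Canonical

/-! ### Products of sub-Gaussian variables -/

section SubExponential

variable {Ω : Type*} {mΩ : MeasurableSpace Ω} {μ : Measure Ω} {S T : Ω → ℝ} {κ : ℝ≥0}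

/-- The square of a sub-Gaussian variable has an exponential moment. The square in the exponent is
linearized by integrating `exp (t S)` over a centred Gaussian `t` of variance `1 / (2κ)`. -/
lemma lintegral_exp_sq_le [IsProbabilityMeasure μ] (hκ : 0 < κ) (hS : HasSubgaussianMGF S κ μ)
    (hm : Measurable S) :
    ∫⁻ ω, ENNReal.ofReal (Real.exp (S ω ^ 2 / (4 * κ))) ∂μ ≤ 2 := by
  set v : ℝ≥0 := 1 / (2 * κ) with hv
  have hκ' : (0 : ℝ) < κ := by exact_mod_cast hκ
  have hv0 : v ≠ 0 := by positivity
  have hvr : (v : ℝ) = 1 / (2 * κ) := by simp [hv]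
  have h1 : ∀ s : ℝ, ENNReal.ofReal (Real.exp (s ^ 2 / (4 * κ)))
      = ∫⁻ t, ENNReal.ofReal (Real.exp (t * s)) ∂(gaussianReal 0 v) := by
    intro s
    rw [← ofReal_integral_eq_lintegral_ofReal]
    · congr 1
      have := congrFun (mgf_fun_id_gaussianReal (μ := 0) (v := v)) s
      simp only [mgf] at this
      simp only [mul_comm _ s]
      rw [this, hvr]
      congr 1
      field_simp
      ring
    · simpa only [mul_comm _ s] using integrable_exp_mul_gaussianReal (μ := 0) (v := v) s
    · exact Filter.Eventually.of_forall fun t => (Real.exp_pos _).le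
  have h2 : ∀ t : ℝ, ∫⁻ ω, ENNReal.ofReal (Real.exp (t * S ω)) ∂μ
      ≤ ENNReal.ofReal (Real.exp (κ * t ^ 2 / 2)) := by
    intro t
    rw [← ofReal_integral_eq_lintegral_ofReal (hS.integrable_exp_mul t)
      (Filter.Eventually.of_forall fun t => (Real.exp_pos _).le)]
    exact ENNReal.ofReal_le_ofReal (hS.mgf_le t)
  simp_rw [h1]
  rw [lintegral_lintegral_swap (by fun_prop)]
  refine (lintegral_mono h2).trans ?_
  rw [gaussianReal_of_var_ne_zero _ hv0, lintegral_withDensity_eq_lintegral_mul _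
    (measurable_gaussianPDF _ _) (by fun_prop)]
  have h3 : ∀ t : ℝ, (gaussianPDF 0 v * fun t => ENNReal.ofReal (Real.exp (κ * t ^ 2 / 2))) t
      = ENNReal.ofReal ((√(2 * Real.pi * v))⁻¹ * Real.exp (-(κ / 2 : ℝ) * t ^ 2)) := by
    intro t
    rw [Pi.mul_apply, gaussianPDF, gaussianPDFReal, ← ENNReal.ofReal_mul (by positivity), mul_assoc,
      ← Real.exp_add, hvr]
    congr 3
    field_simp
    ring
  simp_rw [h3]
  rw [← ofReal_integral_eq_lintegral_ofReal
    ((integrable_exp_neg_mul_sq (by positivity)).const_mul _)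
    (Filter.Eventually.of_forall fun t => by positivity), integral_const_mul, integral_gaussian]
  rw [show (2 : ℝ≥0∞) = ENNReal.ofReal 2 by simp]
  refine ENNReal.ofReal_le_ofReal ?_
  rw [← Real.sqrt_inv, ← Real.sqrt_mul (by positivity), hvr]
  rw [show (2 * Real.pi * (1 / (2 * (κ : ℝ))))⁻¹ * (Real.pi / (κ / 2)) = 2 by
    field_simp]
  rw [Real.sqrt_le_left (by norm_num)]
  norm_num

/-- The product of two sub-Gaussian variables, not assumed independent, is sub-exponential. -/
lemma exp_abs_mul_bound [IsProbabilityMeasure μ] (hκ : 0 < κ) (hS : HasSubgaussianMGF S κ μ)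
    (hT : HasSubgaussianMGF T κ μ) (hSm : Measurable S) (hTm : Measurable T) :
    Integrable (fun ω => Real.exp |S ω * T ω / (4 * κ)|) μ ∧
      ∫ ω, Real.exp |S ω * T ω / (4 * κ)| ∂μ ≤ 2 := by
  have hκ' : (0 : ℝ) < κ := by exact_mod_cast hκ
  have hle : ∫⁻ ω, ENNReal.ofReal (Real.exp |S ω * T ω / (4 * κ)|) ∂μ ≤ 2 := by
    have hpt : ∀ ω, ENNReal.ofReal (Real.exp |S ω * T ω / (4 * κ)|) ≤
        2⁻¹ * (ENNReal.ofReal (Real.exp (S ω ^ 2 / (4 * κ)))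
          + ENNReal.ofReal (Real.exp (T ω ^ 2 / (4 * κ)))) := by
      intro ω
      rw [← ENNReal.ofReal_add (Real.exp_pos _).le (Real.exp_pos _).le,
        show (2⁻¹ : ℝ≥0∞) = ENNReal.ofReal 2⁻¹ by
          rw [ENNReal.ofReal_inv_of_pos (by norm_num)]; simp,
        ← ENNReal.ofReal_mul (by norm_num)]
      refine ENNReal.ofReal_le_ofReal ?_
      set a := S ω ^ 2 / (4 * κ)
      set b := T ω ^ 2 / (4 * κ)
      have h1 : |S ω * T ω / (4 * κ)| ≤ a / 2 + b / 2 := by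
        rw [abs_div, abs_mul, abs_of_pos (by positivity : (0 : ℝ) < 4 * κ),
          show a / 2 + b / 2 = (|S ω| ^ 2 / 2 + |T ω| ^ 2 / 2) / (4 * κ) by
            simp only [a, b, sq_abs]; ring]
        gcongr
        nlinarith [sq_nonneg (|S ω| - |T ω|)]
      have h2 : Real.exp (a / 2 + b / 2) ≤ 2⁻¹ * (Real.exp a + Real.exp b) := by
        have ha : Real.exp a = Real.exp (a / 2) ^ 2 := by rw [← Real.exp_nat_mul]; congr 1; ring
        have hb : Real.exp b = Real.exp (b / 2) ^ 2 := by rw [← Real.exp_nat_mul]; congr 1; ring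
        rw [Real.exp_add, ha, hb]
        nlinarith [sq_nonneg (Real.exp (a / 2) - Real.exp (b / 2))]
      exact (Real.exp_le_exp.2 h1).trans h2
    refine (lintegral_mono hpt).trans ?_
    rw [lintegral_const_mul _ (by fun_prop), lintegral_add_left (by fun_prop)]
    calc _ ≤ 2⁻¹ * ((2 : ℝ≥0∞) + 2) := by
          gcongr
          · exact lintegral_exp_sq_le hκ hS hSm
          · exact lintegral_exp_sq_le hκ hT hTm
      _ = 2 := by
          rw [← two_mul, ← mul_assoc, ENNReal.inv_mul_cancel (by norm_num) (by norm_num), one_mul]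
  have hint : Integrable (fun ω => Real.exp |S ω * T ω / (4 * κ)|) μ := by
    refine ⟨by fun_prop, ?_⟩
    rw [hasFiniteIntegral_iff_ofReal (Filter.Eventually.of_forall fun t => (Real.exp_pos _).le)]
    exact lt_of_le_of_lt hle (by norm_num)
  refine ⟨hint, ?_⟩
  rw [← ofReal_integral_eq_lintegral_ofReal hint
    (Filter.Eventually.of_forall fun t => (Real.exp_pos _).le)] at hle
  have := (ENNReal.ofReal_le_iff_le_toReal (by norm_num)).1 hle
  simpa using this

lemma exp_le_one_add_add_sq_mul_exp_abs (x : ℝ) :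
    Real.exp x ≤ 1 + x + x ^ 2 * Real.exp |x| := by
  rcases le_or_gt |x| 1 with h | h
  · have h1 := (abs_le.1 (Real.abs_exp_sub_one_sub_id_le h)).2
    have h2 : x ^ 2 * 1 ≤ x ^ 2 * Real.exp |x| := by
      gcongr
      exact Real.one_le_exp (abs_nonneg x)
    linarith
  · rcases lt_abs.1 h with h | h
    · rw [abs_of_pos (by linarith)]
      have : 1 * Real.exp x ≤ x ^ 2 * Real.exp x := by gcongr; nlinarith
      linarith
    · have h1 : Real.exp x ≤ 1 := Real.exp_le_one_iff.2 (by linarith)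
      have h2 : x ^ 2 * 1 ≤ x ^ 2 * Real.exp |x| := by
        gcongr
        exact Real.one_le_exp (abs_nonneg x)
      nlinarith

/-- The moment generating function of a centred variable with a unit exponential moment is
Gaussian near zero. -/
lemma mgf_le_of_integral_exp_abs [IsProbabilityMeasure μ] {Z : Ω → ℝ} (hZm : Measurable Z)
    (hint : Integrable (fun ω => Real.exp |Z ω|) μ) (hZ : ∫ ω, Real.exp |Z ω| ∂μ ≤ 2)
    {l : ℝ} (hl : |l| ≤ 1 / 2) :
    Integrable (fun ω => Real.exp (l * (Z ω - ∫ ω, Z ω ∂μ))) μ ∧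
      mgf (fun ω => Z ω - ∫ ω, Z ω ∂μ) μ l ≤ Real.exp (16 * l ^ 2) := by
  have hZint : Integrable Z μ := hint.mono' (by fun_prop) <| Filter.Eventually.of_forall fun ω => by
    rw [Real.norm_eq_abs]
    linarith [Real.add_one_le_exp |Z ω|]
  have hlZ : ∀ ω, |l * Z ω| ≤ |Z ω| / 2 := by
    intro ω
    rw [abs_mul]
    nlinarith [abs_nonneg (Z ω)]
  have hlint : Integrable (fun ω => Real.exp (l * Z ω)) μ := by
    refine hint.mono' (by fun_prop) <| Filter.Eventually.of_forall fun ω => ?_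
    rw [Real.norm_eq_abs, Real.abs_exp]
    refine Real.exp_le_exp.2 ((le_abs_self _).trans ((hlZ ω).trans ?_))
    linarith [abs_nonneg (Z ω)]
  have hpt : ∀ ω, Real.exp (l * Z ω) ≤ 1 + l * Z ω + 8 * l ^ 2 * Real.exp |Z ω| := by
    intro ω
    refine (exp_le_one_add_add_sq_mul_exp_abs _).trans ?_
    have h1 : Real.exp |l * Z ω| ≤ Real.exp (|Z ω| / 2) := Real.exp_le_exp.2 (hlZ ω)
    have h2 : (Z ω) ^ 2 ≤ 8 * Real.exp (|Z ω| / 2) := by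
      have := Real.quadratic_le_exp_of_nonneg (x := |Z ω| / 2) (by positivity)
      rw [← sq_abs]
      nlinarith [abs_nonneg (Z ω)]
    have h3 : Real.exp |Z ω| = Real.exp (|Z ω| / 2) * Real.exp (|Z ω| / 2) := by
      rw [← Real.exp_add]; congr 1; ring
    have h4 : (l * Z ω) ^ 2 * Real.exp |l * Z ω|
        ≤ (l ^ 2 * (8 * Real.exp (|Z ω| / 2))) * Real.exp (|Z ω| / 2) := by
      rw [mul_pow]; gcongr
    rw [h3]
    linarith
  have hfac : ∀ ω, Real.exp (l * (Z ω - ∫ ω, Z ω ∂μ))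
      = Real.exp (-(l * ∫ ω, Z ω ∂μ)) * Real.exp (l * Z ω) := by
    intro ω
    rw [← Real.exp_add]; congr 1; ring
  refine ⟨by simp_rw [hfac]; exact hlint.const_mul _, ?_⟩
  rw [mgf]
  simp_rw [hfac]
  rw [integral_const_mul]
  have hE : ∫ ω, Real.exp (l * Z ω) ∂μ ≤ 1 + l * ∫ ω, Z ω ∂μ + 16 * l ^ 2 := by
    calc ∫ ω, Real.exp (l * Z ω) ∂μ
        ≤ ∫ ω, (1 + l * Z ω + 8 * l ^ 2 * Real.exp |Z ω|) ∂μ :=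
          integral_mono hlint (by fun_prop) hpt
      _ = 1 + l * ∫ ω, Z ω ∂μ + 8 * l ^ 2 * ∫ ω, Real.exp |Z ω| ∂μ := by
          rw [integral_add (by fun_prop) (by fun_prop), integral_add (by fun_prop) (by fun_prop),
            integral_const_mul, integral_const_mul]
          simp
      _ ≤ _ := by nlinarith [sq_nonneg l]
  calc _ ≤ Real.exp (-(l * ∫ ω, Z ω ∂μ)) * Real.exp (l * ∫ ω, Z ω ∂μ + 16 * l ^ 2) := by
        gcongr
        refine hE.trans ?_
        linarith [Real.add_one_le_exp (l * ∫ ω, Z ω ∂μ + 16 * l ^ 2)]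
    _ = _ := by rw [← Real.exp_add]; congr 1; ring

/-- One-sided Bernstein inequality: the exponent of the Chernoff bound is
`16 l² - l t`, evaluated at its minimizer `l = t / 32`. -/
lemma measure_sum_ge_le_of_integral_exp_abs {ι : Type*} [Fintype ι] [IsProbabilityMeasure μ]
    {Z : Ω → ℝ} (hZm : Measurable Z) (hint : Integrable (fun ω => Real.exp |Z ω|) μ)
    (hZ : ∫ ω, Real.exp |Z ω| ∂μ ≤ 2) {t : ℝ} (ht0 : 0 ≤ t) (ht : t ≤ 16) :
    (Measure.pi fun _ : ι => μ).real
        {ω | Fintype.card ι * t ≤ ∑ i, (Z (ω i) - ∫ x, Z x ∂μ)}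
      ≤ Real.exp (-(Fintype.card ι * t ^ 2 / 64)) := by
  set Y : ι → (ι → Ω) → ℝ := fun i ω => Z (ω i) - ∫ x, Z x ∂μ with hY
  have hl : |t / 32| ≤ 1 / 2 := by rw [abs_of_nonneg (by positivity)]; linarith
  obtain ⟨h1, h2⟩ := mgf_le_of_integral_exp_abs hZm hint hZ hl
  have hind : iIndepFun Y (Measure.pi fun _ : ι => μ) :=
    iIndepFun_pi (X := fun _ z => Z z - ∫ x, Z x ∂μ) (fun _ => by fun_prop)
  have hYm : ∀ i, Measurable (Y i) := fun i => by fun_prop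
  have hYint : ∀ i ∈ Finset.univ, Integrable (fun ω => Real.exp (t / 32 * Y i ω))
      (Measure.pi fun _ : ι => μ) := fun i _ =>
    (measurePreserving_eval (fun _ : ι => μ) i).integrable_comp_of_integrable h1
  have hmgf : ∀ i, mgf (Y i) (Measure.pi fun _ : ι => μ) (t / 32)
      ≤ Real.exp (16 * (t / 32) ^ 2) := by
    intro i
    refine le_of_eq_of_le ?_ h2
    have hmp := measurePreserving_eval (fun _ : ι => μ) i
    rw [mgf, mgf, ← hmp.map_eq, integral_map hmp.measurable.aemeasurable]
    · simp [hY, hmp.map_eq]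
    · rw [hmp.map_eq]; exact h1.aestronglyMeasurable
  have := measure_ge_le_exp_mul_mgf (μ := Measure.pi fun _ : ι => μ) (X := ∑ i, Y i)
    (Fintype.card ι * t) (t := t / 32) (by positivity)
    (hind.integrable_exp_mul_sum hYm hYint)
  rw [hind.mgf_sum hYm] at this
  simp only [Finset.sum_apply] at this
  refine this.trans ?_
  calc _ ≤ Real.exp (-(t / 32) * (Fintype.card ι * t)) *
        ∏ i : ι, Real.exp (16 * (t / 32) ^ 2) := by
        gcongr
        · exact fun i _ => mgf_nonneg
        · exact hmgf _
    _ = _ := by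
        rw [Finset.prod_const, Finset.card_univ, ← Real.exp_nat_mul, ← Real.exp_add]
        congr 1
        ring

/-- Bernstein's inequality for the mean of products of sub-Gaussian variables. -/
lemma measure_abs_sum_mul_ge_le {ι : Type*} [Fintype ι] [IsProbabilityMeasure μ] (hκ : 0 < κ)
    (hS : HasSubgaussianMGF S κ μ) (hT : HasSubgaussianMGF T κ μ)
    (hSm : Measurable S) (hTm : Measurable T) {t : ℝ} (ht0 : 0 ≤ t) (ht : t ≤ 16) :
    (Measure.pi fun _ : ι => μ).real
        {ω | Fintype.card ι * (4 * κ * t) ≤ |∑ i, (S (ω i) * T (ω i) - ∫ x, S x * T x ∂μ)|}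
      ≤ 2 * Real.exp (-(Fintype.card ι * t ^ 2 / 64)) := by
  have hκ' : (0 : ℝ) < κ := by exact_mod_cast hκ
  obtain ⟨h1, h2⟩ := exp_abs_mul_bound hκ hS hT hSm hTm
  have hp := measure_sum_ge_le_of_integral_exp_abs (ι := ι)
    (Z := fun ω => S ω * T ω / (4 * κ)) (by fun_prop) h1 h2 ht0 ht
  have hn := measure_sum_ge_le_of_integral_exp_abs (ι := ι)
    (Z := fun ω => -(S ω * T ω / (4 * κ))) (by fun_prop) (by simpa using h1) (by simpa using h2)
    ht0 ht
  refine (measureReal_mono ?_ (by finiteness)).trans ((measureReal_union_le _ _).trans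
    ((add_le_add hp hn).trans (le_of_eq (two_mul _).symm)))
  intro ω hω
  simp only [Set.mem_ofPred_eq] at hω
  simp only [Set.mem_union, Set.mem_ofPred_eq]
  have e1 : ∑ i, (S (ω i) * T (ω i) / (4 * κ) - ∫ x, S x * T x / (4 * κ) ∂μ)
      = (∑ i, (S (ω i) * T (ω i) - ∫ x, S x * T x ∂μ)) / (4 * κ) := by
    rw [integral_div, Finset.sum_div]
    simp only [sub_div]
  have e2 : ∑ i, (-(S (ω i) * T (ω i) / (4 * κ)) - ∫ x, -(S x * T x / (4 * κ)) ∂μ)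
      = -(∑ i, (S (ω i) * T (ω i) - ∫ x, S x * T x ∂μ)) / (4 * κ) := by
    rw [integral_neg, neg_div, ← e1, ← Finset.sum_neg_distrib]
    exact Finset.sum_congr rfl fun i _ => by ring
  rw [e1, e2, le_div_iff₀ (by positivity), le_div_iff₀ (by positivity)]
  rcases le_abs.1 hω with h | h
  · left; linarith
  · right; linarith

lemma abs_integral_mul_le [IsProbabilityMeasure μ] (hκ : 0 < κ)
    (hS : HasSubgaussianMGF S κ μ) (hT : HasSubgaussianMGF T κ μ)
    (hSm : Measurable S) (hTm : Measurable T) : |∫ ω, S ω * T ω ∂μ| ≤ 8 * κ := by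
  have hκ' : (0 : ℝ) < κ := by exact_mod_cast hκ
  obtain ⟨h1, h2⟩ := exp_abs_mul_bound hκ hS hT hSm hTm
  have e : ∫ ω, S ω * T ω ∂μ = 4 * κ * ∫ ω, S ω * T ω / (4 * κ) ∂μ := by
    rw [integral_div]; field_simp
  rw [e, abs_mul, abs_of_pos (by positivity)]
  have : |∫ ω, S ω * T ω / (4 * κ) ∂μ| ≤ 2 := by
    refine abs_integral_le_integral_abs.trans (le_trans ?_ h2)
    refine integral_mono_of_nonneg (Filter.Eventually.of_forall fun _ => abs_nonneg _) h1
      (Filter.Eventually.of_forall fun ω => ?_)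
    have := Real.add_one_le_exp |S ω * T ω / (4 * κ)|
    simp only
    linarith
  nlinarith

end SubExponential

/-! ### Empirical cross-covariances -/

section Laws

variable {p q : ℕ} {μ : Measure (Obs p q)} {K κ : ℝ≥0}

lemma isHermitian_covX (μ : Measure (Obs p q)) : (covX μ).IsHermitian := by
  ext i j
  simp [covX, covariance_comm]

lemma isHermitian_covY (μ : Measure (Obs p q)) : (covY μ).IsHermitian := by
  ext i j
  simp [covY, covariance_comm]

lemma hasSubgaussianMGF_of_le {Ω : Type*} {mΩ : MeasurableSpace Ω} {μ : Measure Ω} {X : Ω → ℝ}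
    (h : HasSubgaussianMGF X K μ) (hK : K ≤ κ) : HasSubgaussianMGF X κ μ where
  integrable_exp_mul := h.integrable_exp_mul
  mgf_le t := (h.mgf_le t).trans (Real.exp_le_exp.2 (by
    have : (K : ℝ) ≤ κ := by exact_mod_cast hK
    gcongr))

lemma covXY_apply_eq_integral (hX : ∀ i, ∫ z, z.1 i ∂μ = 0) (hY : ∀ i, ∫ z, z.2 i ∂μ = 0)
    (l : Fin p) (k : Fin q) : covXY μ l k = ∫ z, z.1 l * z.2 k ∂μ := by
  simp [covXY, covariance, hX, hY]

lemma integral_dotProduct_mul [IsProbabilityMeasure μ]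
    (hX : ∀ i, ∫ z, z.1 i ∂μ = 0) (hY : ∀ i, ∫ z, z.2 i ∂μ = 0)
    (hsX : ∀ u : Fin p → ℝ, u ⬝ᵥ u = 1 → HasSubgaussianMGF (fun z : Obs p q => u ⬝ᵥ z.1) K μ)
    (hsY : ∀ v : Fin q → ℝ, v ⬝ᵥ v = 1 → HasSubgaussianMGF (fun z : Obs p q => v ⬝ᵥ z.2) K μ)
    (a : Fin q → ℝ) (b : Fin p → ℝ) :
    ∫ z, (a ⬝ᵥ z.2) * (b ⬝ᵥ z.1) ∂μ = a ⬝ᵥ (covXY μ)ᵀ *ᵥ b := by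
  have hXL : ∀ i, MemLp (fun z : Obs p q => z.1 i) 2 μ := by
    intro i
    have := (hsX (Pi.single i 1) (by simp)).memLp 2
    simpa using this
  have hYL : ∀ i, MemLp (fun z : Obs p q => z.2 i) 2 μ := by
    intro i
    have := (hsY (Pi.single i 1) (by simp)).memLp 2
    simpa using this
  have hint : ∀ k l, Integrable (fun z : Obs p q => z.1 l * z.2 k) μ := fun k l =>
    (hXL l).integrable_mul (hYL k)
  have e : ∀ z : Obs p q, (a ⬝ᵥ z.2) * (b ⬝ᵥ z.1)
      = ∑ k, ∑ l, a k * b l * (z.1 l * z.2 k) := by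
    intro z
    simp only [dotProduct, Finset.sum_mul_sum]
    exact Finset.sum_congr rfl fun k _ => Finset.sum_congr rfl fun l _ => by ring
  simp_rw [e]
  rw [integral_finsetSum _ fun k _ => integrable_finsetSum _ fun l _ => (hint k l).const_mul _]
  simp only [dotProduct, Matrix.mulVec, Finset.mul_sum, Matrix.transpose_apply]
  refine Finset.sum_congr rfl fun k _ => ?_
  rw [integral_finsetSum _ fun l _ => (hint k l).const_mul _]
  refine Finset.sum_congr rfl fun l _ => ?_
  rw [integral_const_mul, covXY_apply_eq_integral hX hY]
  ring

lemma exists_unit_smul {n : ℕ} (a : Fin n → ℝ) (ha : a ⬝ᵥ a ≠ 0) :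
    ∃ u : Fin n → ℝ, u ⬝ᵥ u = 1 ∧ a = √(a ⬝ᵥ a) • u := by
  have h0 : 0 ≤ a ⬝ᵥ a := by
    rw [dotProduct]; exact Finset.sum_nonneg fun i _ => mul_self_nonneg _
  have hs : √(a ⬝ᵥ a) ≠ 0 := (Real.sqrt_pos.2 (lt_of_le_of_ne h0 (Ne.symm ha))).ne'
  refine ⟨(√(a ⬝ᵥ a))⁻¹ • a, ?_, ?_⟩
  · rw [smul_dotProduct, dotProduct_smul, smul_eq_mul, smul_eq_mul, ← mul_assoc, ← mul_inv,
      Real.mul_self_sqrt h0, inv_mul_cancel₀ ha]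
  · rw [smul_smul, mul_inv_cancel₀ hs, one_smul]

lemma abs_crossCov_le [IsProbabilityMeasure μ] (hκ : 0 < κ)
    (hX : ∀ i, ∫ z, z.1 i ∂μ = 0) (hY : ∀ i, ∫ z, z.2 i ∂μ = 0)
    (hsX : ∀ u : Fin p → ℝ, u ⬝ᵥ u = 1 → HasSubgaussianMGF (fun z : Obs p q => u ⬝ᵥ z.1) κ μ)
    (hsY : ∀ v : Fin q → ℝ, v ⬝ᵥ v = 1 → HasSubgaussianMGF (fun z : Obs p q => v ⬝ᵥ z.2) κ μ)
    (a : Fin q → ℝ) (b : Fin p → ℝ) :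
    |a ⬝ᵥ (covXY μ)ᵀ *ᵥ b| ≤ 8 * κ * (√(a ⬝ᵥ a) * √(b ⬝ᵥ b)) := by
  by_cases ha : a ⬝ᵥ a = 0
  · rw [dotProduct_self_eq_zero.1 ha]; simp
  by_cases hb : b ⬝ᵥ b = 0
  · rw [dotProduct_self_eq_zero.1 hb]; simp
  obtain ⟨u, hu, hau⟩ := exists_unit_smul a ha
  obtain ⟨v, hv, hbv⟩ := exists_unit_smul b hb
  have h := abs_integral_mul_le hκ (hsY u hu) (hsX v hv)
    (by simp only [dotProduct]; fun_prop) (by simp only [dotProduct]; fun_prop)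
  rw [integral_dotProduct_mul hX hY hsX hsY] at h
  have e : a ⬝ᵥ (covXY μ)ᵀ *ᵥ b
      = (√(a ⬝ᵥ a) * √(b ⬝ᵥ b)) * (u ⬝ᵥ (covXY μ)ᵀ *ᵥ v) := by
    conv_lhs => rw [hau, hbv]
    rw [Matrix.mulVec_smul, smul_dotProduct, dotProduct_smul, smul_eq_mul, smul_eq_mul, mul_assoc]
  rw [e, abs_mul, abs_of_nonneg (by positivity), mul_comm]
  gcongr

/-- Bernstein's inequality in arbitrary fixed directions `a` and `b`, by reduction to unit vectors.
The strict inequality makes the event empty when `a` or `b` is zero. -/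
lemma measure_sum_crossCov_deviation_le {ι : Type*} [Fintype ι] [IsProbabilityMeasure μ]
    (hκ : 0 < κ) (hX : ∀ i, ∫ z, z.1 i ∂μ = 0) (hY : ∀ i, ∫ z, z.2 i ∂μ = 0)
    (hsX : ∀ u : Fin p → ℝ, u ⬝ᵥ u = 1 → HasSubgaussianMGF (fun z : Obs p q => u ⬝ᵥ z.1) κ μ)
    (hsY : ∀ v : Fin q → ℝ, v ⬝ᵥ v = 1 → HasSubgaussianMGF (fun z : Obs p q => v ⬝ᵥ z.2) κ μ)
    (a : Fin q → ℝ) (b : Fin p → ℝ) {t : ℝ} (ht0 : 0 ≤ t) (ht : t ≤ 16) :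
    (Measure.pi fun _ : ι => μ)
        {s | Fintype.card ι * (4 * κ * t) * (√(a ⬝ᵥ a) * √(b ⬝ᵥ b)) <
          |∑ i, ((a ⬝ᵥ (s i).2) * (b ⬝ᵥ (s i).1) - a ⬝ᵥ (covXY μ)ᵀ *ᵥ b)|}
      ≤ ENNReal.ofReal (2 * Real.exp (-(Fintype.card ι * t ^ 2 / 64))) := by
  by_cases ha : a ⬝ᵥ a = 0
  · rw [dotProduct_self_eq_zero.1 ha]; simp
  by_cases hb : b ⬝ᵥ b = 0
  · rw [dotProduct_self_eq_zero.1 hb]; simp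
  obtain ⟨u, hu, hau⟩ := exists_unit_smul a ha
  obtain ⟨v, hv, hbv⟩ := exists_unit_smul b hb
  have h := measure_abs_sum_mul_ge_le (ι := ι) hκ (hsY u hu) (hsX v hv)
    (by simp only [dotProduct]; fun_prop) (by simp only [dotProduct]; fun_prop) ht0 ht
  rw [integral_dotProduct_mul hX hY hsX hsY] at h
  rw [← ENNReal.ofReal_toReal (measure_ne_top _ _)]
  refine ENNReal.ofReal_le_ofReal (le_trans (measureReal_mono ?_ (by finiteness)) h)
  intro s hs
  simp only [Set.mem_ofPred_eq] at hs ⊢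
  set N := √(a ⬝ᵥ a) * √(b ⬝ᵥ b) with hN
  have hN0 : 0 ≤ N := by positivity
  have e : ∑ i, ((a ⬝ᵥ (s i).2) * (b ⬝ᵥ (s i).1) - a ⬝ᵥ (covXY μ)ᵀ *ᵥ b)
      = N * ∑ i, ((u ⬝ᵥ (s i).2) * (v ⬝ᵥ (s i).1) - u ⬝ᵥ (covXY μ)ᵀ *ᵥ v) := by
    rw [Finset.mul_sum]
    refine Finset.sum_congr rfl fun i _ => ?_
    conv_lhs => rw [hau, hbv]
    simp only [Matrix.mulVec_smul, smul_dotProduct, dotProduct_smul, smul_eq_mul, hN]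
    ring
  rw [e, abs_mul, abs_of_nonneg hN0, mul_comm] at hs
  exact (lt_of_mul_lt_mul_left hs hN0).le

lemma dotProduct_empCovXY_mulVec {n : ℕ} (ω : Fin n → Obs p q) (a : Fin q → ℝ) (b : Fin p → ℝ) :
    a ⬝ᵥ (empCovXY ω)ᵀ *ᵥ b =
      (∑ i : {i : Fin n // ¬ (i : ℕ) < n / 2}, (a ⬝ᵥ (ω i).2) * (b ⬝ᵥ (ω i).1)) /
        ((n - n / 2 : ℕ) : ℝ) := by
  have e : ∑ i : {i : Fin n // ¬ (i : ℕ) < n / 2}, (a ⬝ᵥ (ω i).2) * (b ⬝ᵥ (ω i).1)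
      = ∑ i ∈ Finset.univ.filter (fun i : Fin n => n / 2 ≤ (i : ℕ)),
        (a ⬝ᵥ (ω i).2) * (b ⬝ᵥ (ω i).1) := by
    rw [← Finset.sum_subtype (p := fun i : Fin n => ¬ (i : ℕ) < n / 2)
      (Finset.univ.filter (fun i : Fin n => n / 2 ≤ (i : ℕ))) (by simp)
      (fun i => (a ⬝ᵥ (ω i).2) * (b ⬝ᵥ (ω i).1))]
  rw [e, Finset.sum_div]
  have h2 : ∀ i, (a ⬝ᵥ (ω i).2) * (b ⬝ᵥ (ω i).1) / ((n - n / 2 : ℕ) : ℝ)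
      = ∑ k, ∑ l, a k * ((ω i).1 l * (ω i).2 k / ((n - n / 2 : ℕ) : ℝ) * b l) := by
    intro i
    simp only [dotProduct, Finset.sum_mul_sum, Finset.sum_div]
    exact Finset.sum_congr rfl fun k _ => Finset.sum_congr rfl fun l _ => by ring
  simp only [h2]
  rw [Finset.sum_comm]
  simp only [dotProduct, Matrix.mulVec, Finset.mul_sum, Matrix.transpose_apply, empCovXY,
    Matrix.of_apply]
  refine Finset.sum_congr rfl fun k _ => ?_
  rw [Finset.sum_comm]
  refine Finset.sum_congr rfl fun l _ => ?_
  rw [Finset.sum_div, Finset.sum_mul, Finset.mul_sum]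

lemma card_secondHalf (n : ℕ) :
    Fintype.card {i : Fin n // ¬ (i : ℕ) < n / 2} = n - n / 2 := by
  rw [Fintype.card_subtype_compl, Fintype.card_fin]
  congr 1
  have := Fintype.card_congr (Fin.castLEquiv (Nat.div_le_self n 2))
  rw [Fintype.card_fin] at this
  exact this.symm

/-- The empirical cross-covariance of the second half of the sample, between directions computed
from the first half, concentrates: conditionally on the first half the directions are fixed. -/
lemma measure_empCovXY_deviation_le {n : ℕ} (hn : 0 < n) [IsProbabilityMeasure μ]
    (hκ : 0 < κ) (hX : ∀ i, ∫ z, z.1 i ∂μ = 0) (hY : ∀ i, ∫ z, z.2 i ∂μ = 0)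
    (hsX : ∀ u : Fin p → ℝ, u ⬝ᵥ u = 1 → HasSubgaussianMGF (fun z : Obs p q => u ⬝ᵥ z.1) κ μ)
    (hsY : ∀ v : Fin q → ℝ, v ⬝ᵥ v = 1 → HasSubgaussianMGF (fun z : Obs p q => v ⬝ᵥ z.2) κ μ)
    {a : (Fin (n / 2) → Obs p q) → Fin q → ℝ} {b : (Fin (n / 2) → Obs p q) → Fin p → ℝ}
    (ha : Measurable a) (hb : Measurable b) {t : ℝ} (ht0 : 0 ≤ t) (ht : t ≤ 16) :
    (Measure.pi fun _ : Fin n => μ)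
        {ω | (4 * κ * t) * (√(a (firstHalf ω) ⬝ᵥ a (firstHalf ω)) *
            √(b (firstHalf ω) ⬝ᵥ b (firstHalf ω))) <
          |a (firstHalf ω) ⬝ᵥ (empCovXY ω)ᵀ *ᵥ b (firstHalf ω) -
            a (firstHalf ω) ⬝ᵥ (covXY μ)ᵀ *ᵥ b (firstHalf ω)|}
      ≤ ENNReal.ofReal (2 * Real.exp (-(((n - n / 2 : ℕ) : ℝ) * t ^ 2 / 64))) := by
  have hm : (0 : ℝ) < ((n - n / 2 : ℕ) : ℝ) := by
    have : 0 < n - n / 2 := by omega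
    exact_mod_cast this
  let e := MeasurableEquiv.piEquivPiSubtypeProd (fun _ : Fin n => Obs p q)
    (fun i : Fin n => (i : ℕ) < n / 2)
  have he := measurePreserving_piEquivPiSubtypeProd (fun _ : Fin n => μ)
    (fun i : Fin n => (i : ℕ) < n / 2)
  let g : ({i : Fin n // (i : ℕ) < n / 2} → Obs p q) → (Fin (n / 2) → Obs p q) :=
    fun f i => f ⟨Fin.castLE (Nat.div_le_self n 2) i, i.2⟩
  have hg : Measurable g := measurable_pi_lambda _ fun i => measurable_pi_apply _
  have hag : Measurable fun f => a (g f) := ha.comp hg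
  have hbg : Measurable fun f => b (g f) := hb.comp hg
  let E : Set (({i : Fin n // (i : ℕ) < n / 2} → Obs p q) ×
      ({i : Fin n // ¬ (i : ℕ) < n / 2} → Obs p q)) :=
    {x | Fintype.card {i : Fin n // ¬ (i : ℕ) < n / 2} * (4 * κ * t) *
        (√(a (g x.1) ⬝ᵥ a (g x.1)) * √(b (g x.1) ⬝ᵥ b (g x.1))) <
      |∑ i, ((a (g x.1) ⬝ᵥ (x.2 i).2) * (b (g x.1) ⬝ᵥ (x.2 i).1)
        - a (g x.1) ⬝ᵥ (covXY μ)ᵀ *ᵥ b (g x.1))|}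
  have hE : MeasurableSet E := by
    have ha' : ∀ k, Measurable fun f => a (g f) k := fun k => (measurable_pi_apply k).comp hag
    have hb' : ∀ k, Measurable fun f => b (g f) k := fun k => (measurable_pi_apply k).comp hbg
    refine measurableSet_lt ?_ ?_
    · simp only [dotProduct]
      fun_prop
    · simp only [dotProduct, Matrix.mulVec]
      fun_prop
  have hset : {ω | (4 * κ * t) * (√(a (firstHalf ω) ⬝ᵥ a (firstHalf ω)) *
            √(b (firstHalf ω) ⬝ᵥ b (firstHalf ω))) <
          |a (firstHalf ω) ⬝ᵥ (empCovXY ω)ᵀ *ᵥ b (firstHalf ω) -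
            a (firstHalf ω) ⬝ᵥ (covXY μ)ᵀ *ᵥ b (firstHalf ω)|} = e ⁻¹' E := by
    ext ω
    have hge : g (e ω).1 = firstHalf ω := rfl
    simp only [Set.mem_ofPred_eq, Set.mem_preimage, E, hge, card_secondHalf]
    rw [dotProduct_empCovXY_mulVec, Finset.sum_sub_distrib, Finset.sum_const, Finset.card_univ,
      card_secondHalf, nsmul_eq_mul, mul_assoc ((n - n / 2 : ℕ) : ℝ), ← lt_div_iff₀' hm]
    rw [← abs_of_pos hm, ← abs_div, sub_div, abs_of_pos hm, mul_div_cancel_left₀ _ hm.ne']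
    rfl
  rw [hset, he.measure_preimage hE.nullMeasurableSet, Measure.prod_apply hE]
  refine (lintegral_mono (g := fun _ => ENNReal.ofReal
    (2 * Real.exp (-(((n - n / 2 : ℕ) : ℝ) * t ^ 2 / 64)))) fun f => ?_).trans (by simp)
  have := measure_sum_crossCov_deviation_le (ι := {i : Fin n // ¬ (i : ℕ) < n / 2}) hκ hX hY hsX hsY
    (a (g f)) (b (g f)) ht0 ht
  rw [card_secondHalf] at this
  refine le_of_eq_of_le ?_ this
  simp only [E, card_secondHalf]
  rfl

/-- For the outer measure, so that `s` need not be measurable. -/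
lemma measure_firstHalf_preimage_le {n : ℕ} [IsProbabilityMeasure μ]
    (s : Set (Fin (n / 2) → Obs p q)) :
    (Measure.pi fun _ : Fin n => μ) (firstHalf ⁻¹' s) ≤ (Measure.pi fun _ : Fin (n / 2) => μ) s := by
  have h : MeasurePreserving (firstHalf (p := p) (q := q) (n := n))
      (Measure.pi fun _ : Fin n => μ) (Measure.pi fun _ : Fin (n / 2) => μ) := by
    refine ⟨measurable_pi_lambda _ fun i => measurable_pi_apply _, ?_⟩
    have hind : iIndepFun (fun (i : Fin n) (ω : Fin n → Obs p q) => ω i)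
        (Measure.pi fun _ : Fin n => μ) :=
      iIndepFun_pi (X := fun _ z => z) fun _ => aemeasurable_id
    have := (iIndepFun_iff_map_fun_eq_pi_map fun i => (measurable_pi_apply _).aemeasurable).1
      (hind.precomp (Fin.castLE_injective (Nat.div_le_self n 2)))
    refine this.trans ?_
    congr 1
    ext1 i
    exact (measurePreserving_eval (fun _ : Fin n => μ) _).map_eq
  rw [← h.map_eq]
  exact Measure.le_map_apply h.measurable.aemeasurable s

lemma hasSubgaussianMGF_of_map_eq_gaussianReal {Ω : Type*} {mΩ : MeasurableSpace Ω}
    {μ : Measure Ω} {X : Ω → ℝ} (hXm : Measurable X) {v : ℝ≥0}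
    (h : μ.map X = gaussianReal 0 v) : HasSubgaussianMGF X v μ := by
  refine (HasSubgaussianMGF.id_map_iff hXm.aemeasurable).1 ?_
  rw [h]
  exact ⟨integrable_exp_mul_gaussianReal, fun t => by rw [mgf_id_gaussianReal]; simp⟩

lemma hasSubgaussianMGF_of_isGaussian [IsGaussian μ] {ι : Type*} [Fintype ι]
    (L : ι → StrongDual ℝ (Obs p q))
    (h0 : ∀ i, ∫ z, L i z ∂μ = 0) (u : ι → ℝ) {A : Matrix ι ι ℝ}
    (hA : ∀ i j, A i j = cov[L i, L j; μ]) (hK : u ⬝ᵥ A *ᵥ u ≤ K) :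
    HasSubgaussianMGF (fun z => ∑ i, u i * L i z) K μ := by
  have hL : (fun z => ∑ i, u i * L i z) = (∑ i, u i • L i : StrongDual ℝ (Obs p q)) := by
    ext z; simp
  have hmem : ∀ i, MemLp (L i) 2 μ := fun i => IsGaussian.memLp_dual μ (L i) 2 (by norm_num)
  have hmem' : ∀ i, MemLp (fun z => u i * L i z) 2 μ := fun i => (hmem i).const_mul _
  have hmean : ∫ z, ∑ i, u i * L i z ∂μ = 0 := by
    rw [integral_finsetSum _ fun i _ => (hmem' i).integrable (by norm_num)]
    simp [integral_const_mul, h0]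
  have hvar : Var[fun z => ∑ i, u i * L i z; μ] = u ⬝ᵥ A *ᵥ u := by
    rw [← covariance_self (by fun_prop), covariance_fun_sum_fun_sum hmem' hmem']
    simp only [covariance_const_mul_left, covariance_const_mul_right, dotProduct, Matrix.mulVec,
      Finset.mul_sum, hA]
    exact Finset.sum_congr rfl fun i _ => Finset.sum_congr rfl fun l _ => by ring
  have hmap := IsGaussian.map_eq_gaussianReal (μ := μ) (∑ i, u i • L i)
  rw [← hL, hmean, hvar] at hmap
  refine hasSubgaussianMGF_of_le (hasSubgaussianMGF_of_map_eq_gaussianReal (by fun_prop) hmap) ?_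
  exact Real.toNNReal_le_iff_le_coe.2 hK

/-- A jointly Gaussian law is sub-Gaussian, the bound on the eigenvalues of the covariance matrices
serving as variance proxy. -/
lemma GaussianModel.subGaussianModel {B : ℝ} {d : Dims} {μ : Measure (Obs d.p d.q)}
    {U : Matrix (Fin d.p) (Fin d.r) ℝ} {V : Matrix (Fin d.q) (Fin d.r) ℝ}
    (h : GaussianModel B d μ U V) : SubGaussianModel B B.toNNReal d μ U V := by
  obtain ⟨h, hG⟩ := h
  refine ⟨h, fun u hu => ?_, fun v hv => ?_⟩
  · refine hasSubgaussianMGF_of_isGaussian (A := covX μ)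
      (fun i => (ContinuousLinearMap.proj (R := ℝ) i).comp (ContinuousLinearMap.fst ℝ _ _))
      h.meanX u (fun i j => rfl) ?_
    refine (quadForm_le_of_spectrum (isHermitian_covX μ) (c := B)
      (fun x hx => (h.eigX hx).2.le) u).trans ?_
    rw [hu, mul_one]
    exact Real.le_coe_toNNReal B
  · refine hasSubgaussianMGF_of_isGaussian (A := covY μ)
      (fun i => (ContinuousLinearMap.proj (R := ℝ) i).comp (ContinuousLinearMap.snd ℝ _ _))
      h.meanY v (fun i j => rfl) ?_
    refine (quadForm_le_of_spectrum (isHermitian_covY μ) (c := B)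
      (fun x hx => (h.eigY hx).2.le) v).trans ?_
    rw [hv, mul_one]
    exact Real.le_coe_toNNReal B

end Laws

/-! ### Exact recovery -/

section Recovery

lemma one_le_colSparsity {n : ℕ} (hn : 0 < n) {A : Matrix (Fin n) (Fin n) ℝ}
    (hA : IsUnit A.det) : 1 ≤ colSparsity A := by
  classical
  have hne : ∃ i, A i ⟨0, hn⟩ ≠ 0 := by
    by_contra! h
    exact hA.ne_zero (Matrix.det_eq_zero_of_column_eq_zero _ h)
  obtain ⟨i, hi⟩ := hne
  refine le_trans ?_ (Finset.le_sup (f := fun j : Fin n =>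
    (Finset.univ.filter (fun i : Fin n => A i j ≠ 0)).card) (Finset.mem_univ ⟨0, hn⟩))
  exact Finset.card_pos.2 ⟨i, by simpa using hi⟩

lemma sqrt_row_le_normInftyOne {a b : ℕ} (A : Matrix (Fin a) (Fin b) ℝ) (k : Fin a) :
    √(A k ⬝ᵥ A k) ≤ normInftyOne A := by
  refine le_trans ?_ (le_ciSup (f := fun i => ∑ j, |A i j|) (Set.finite_range _).bddAbove k)
  rw [Real.sqrt_le_left (Finset.sum_nonneg fun _ _ => abs_nonneg _)]
  have := Finset.sum_sq_le_sq_sum_of_nonneg (s := Finset.univ) (f := fun j => |A k j|)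
    fun _ _ => abs_nonneg _
  simpa [dotProduct, pow_two] using this

lemma sqrt_row_le_normInftyTwo {a b : ℕ} (A : Matrix (Fin a) (Fin b) ℝ) (k : Fin a) :
    √(A k ⬝ᵥ A k) ≤ normInftyTwo A := by
  refine le_of_eq_of_le ?_
    (le_ciSup (f := fun i => √(∑ j, A i j ^ 2)) (Set.finite_range _).bddAbove k)
  simp [dotProduct, pow_two]

variable {B : ℝ} {d : Dims} {μ : Measure (Obs d.p d.q)}
  {U : Matrix (Fin d.p) (Fin d.r) ℝ} {V : Matrix (Fin d.q) (Fin d.r) ℝ}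

lemma IsSparseCCA.quadForm_covX_ge (h : IsSparseCCA B d μ U V) (w : Fin d.p → ℝ) :
    1 / B * (w ⬝ᵥ w) ≤ w ⬝ᵥ covX μ *ᵥ w :=
  le_quadForm_of_spectrum (isHermitian_covX μ) (fun _ hx => (h.eigX hx).1.le) w

lemma IsSparseCCA.quadForm_covY_ge (h : IsSparseCCA B d μ U V) (w : Fin d.q → ℝ) :
    1 / B * (w ⬝ᵥ w) ≤ w ⬝ᵥ covY μ *ᵥ w :=
  le_quadForm_of_spectrum (isHermitian_covY μ) (fun _ hx => (h.eigY hx).1.le) w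

lemma zero_le_dotProduct_self {n : ℕ} (w : Fin n → ℝ) : 0 ≤ w ⬝ᵥ w :=
  Finset.sum_nonneg fun _ _ => mul_self_nonneg _

lemma IsSparseCCA.quadForm_covX_nonneg (hB : 1 < B) (h : IsSparseCCA B d μ U V)
    (w : Fin d.p → ℝ) : 0 ≤ w ⬝ᵥ covX μ *ᵥ w :=
  (mul_nonneg (by positivity) (zero_le_dotProduct_self w)).trans (h.quadForm_covX_ge w)

lemma IsSparseCCA.quadForm_covY_nonneg (hB : 1 < B) (h : IsSparseCCA B d μ U V)
    (w : Fin d.q → ℝ) : 0 ≤ w ⬝ᵥ covY μ *ᵥ w :=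
  (mul_nonneg (by positivity) (zero_le_dotProduct_self w)).trans (h.quadForm_covY_ge w)

lemma IsSparseCCA.isUnit_det_covY (hB : 1 < B) (h : IsSparseCCA B d μ U V) :
    IsUnit (covY μ).det :=
  isUnit_det_of_quadForm (c := 1 / B) (by positivity) h.quadForm_covY_ge

lemma IsSparseCCA.rank_le_p (h : IsSparseCCA B d μ U V) : d.r ≤ d.p := by
  have := h.rank ▸ Matrix.rank_le_height (covXY μ)
  exact this

lemma IsSparseCCA.rank_le_q (h : IsSparseCCA B d μ U V) : d.r ≤ d.q := by
  have := h.rank ▸ Matrix.rank_le_width (covXY μ)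
  exact this

lemma IsSparseCCA.one_le_colSparsity_inv (hB : 1 < B) (hr : 1 ≤ d.r)
    (h : IsSparseCCA B d μ U V) : 1 ≤ colSparsity (covY μ)⁻¹ := by
  refine one_le_colSparsity (by have := h.rank_le_q; omega) ?_
  exact Matrix.isUnit_nonsing_inv_det _ (h.isUnit_det_covY hB)

/-- Columns that are close to canonical directions in the norm of `Σ_x` are bounded in the
Euclidean norm. -/
lemma IsSparseCCA.sqrt_col_le (hB : 1 < B) (h : IsSparseCCA B d μ U V)
    (hr : 1 ≤ d.r) {err : ℝ} (herr : |err| < 1 / (2 * B * √(d.r : ℝ)))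
    {j : Fin d.r} {b : Fin d.p → ℝ} {w : ℝ} (hw : w = 1 ∨ w = -1)
    (hb : (w • b - U.col j) ⬝ᵥ covX μ *ᵥ (w • b - U.col j) < err ^ 2) :
    √(b ⬝ᵥ b) ≤ 2 * B := by
  have hherm := isHermitian_covX μ
  have hr1 : 1 ≤ √(d.r : ℝ) := by
    rw [Real.one_le_sqrt]; exact_mod_cast hr
  have herr1 : err ^ 2 ≤ 1 := by
    rw [sq_le_one_iff_abs_le_one]
    refine herr.le.trans ?_
    rw [div_le_one (by positivity)]
    nlinarith
  have hpar : (w • b) ⬝ᵥ covX μ *ᵥ (w • b) ≤ 4 := by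
    have h1 := h.quadForm_covX_nonneg hB (w • b - U.col j - U.col j)
    have h2 := (h.canonical j).1.1
    have h3 := dotProduct_mulVec_comm hherm (w • b) (U.col j)
    simp only [Matrix.mulVec_sub, dotProduct_sub, sub_dotProduct] at h1 hb
    linarith
  have hww : w * w = 1 := by rcases hw with rfl | rfl <;> norm_num
  have h4 := h.quadForm_covX_ge (w • b)
  have h5 : (w • b) ⬝ᵥ (w • b) = b ⬝ᵥ b := by
    rw [smul_dotProduct, dotProduct_smul, smul_eq_mul, smul_eq_mul, ← mul_assoc, hww, one_mul]
  rw [h5, one_div, inv_mul_le_iff₀ (by linarith)] at h4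
  rw [Real.sqrt_le_left (by linarith)]
  nlinarith

/-- The entries of the cleaned matrix, split into the error of the precision matrix and the
sampling error of the cross-covariance. -/
lemma abs_clean_sub_le {p q r : ℕ} {Phi P : Matrix (Fin q) (Fin q) ℝ}
    {S Shat : Matrix (Fin p) (Fin q) ℝ} {W : Matrix (Fin p) (Fin r) ℝ} {κ t ε τ B : ℝ}
    (hκ : 0 ≤ κ) (hB : 0 ≤ B) (ht0 : 0 ≤ t) (ht : t ≤ 16) (hε : 0 ≤ ε)
    {k : Fin q} {j : Fin r}
    (hΔ : √((Phi - P) k ⬝ᵥ (Phi - P) k) ≤ ε) (hP : √(P k ⬝ᵥ P k) ≤ B)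
    (hW : √(W.col j ⬝ᵥ W.col j) ≤ 2 * B) (htτ : 4 * t ≤ τ)
    (hS : |(Phi - P) k ⬝ᵥ Sᵀ *ᵥ W.col j| ≤
      8 * κ * (√((Phi - P) k ⬝ᵥ (Phi - P) k) * √(W.col j ⬝ᵥ W.col j)))
    (h1 : |(Phi - P) k ⬝ᵥ Shatᵀ *ᵥ W.col j - (Phi - P) k ⬝ᵥ Sᵀ *ᵥ W.col j| ≤
      4 * κ * t * (√((Phi - P) k ⬝ᵥ (Phi - P) k) * √(W.col j ⬝ᵥ W.col j)))
    (h2 : |P k ⬝ᵥ Shatᵀ *ᵥ W.col j - P k ⬝ᵥ Sᵀ *ᵥ W.col j| ≤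
      4 * κ * t * (√(P k ⬝ᵥ P k) * √(W.col j ⬝ᵥ W.col j))) :
    |(Phi * Shatᵀ * W) k j - (P * Sᵀ * W) k j| ≤ κ * (144 * B * ε + 2 * B ^ 2 * τ) := by
  have e : ∀ (P : Matrix (Fin q) (Fin q) ℝ) (S : Matrix (Fin p) (Fin q) ℝ),
      (P * Sᵀ * W) k j = P k ⬝ᵥ Sᵀ *ᵥ W.col j := by
    intro P S
    rw [Matrix.mul_assoc]
    rfl
  have hsplit : (Phi * Shatᵀ * W) k j - (P * Sᵀ * W) k j
      = (Phi - P) k ⬝ᵥ Sᵀ *ᵥ W.col j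
        + ((Phi - P) k ⬝ᵥ Shatᵀ *ᵥ W.col j - (Phi - P) k ⬝ᵥ Sᵀ *ᵥ W.col j)
        + (P k ⬝ᵥ Shatᵀ *ᵥ W.col j - P k ⬝ᵥ Sᵀ *ᵥ W.col j) := by
    rw [e, e, show (Phi - P) k = Phi k - P k from rfl]
    simp only [sub_dotProduct]
    ring
  rw [hsplit]
  have hA : √((Phi - P) k ⬝ᵥ (Phi - P) k) * √(W.col j ⬝ᵥ W.col j) ≤ ε * (2 * B) := by gcongr
  have hC : √(P k ⬝ᵥ P k) * √(W.col j ⬝ᵥ W.col j) ≤ B * (2 * B) := by gcongr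
  have h3 : 8 * κ * (√((Phi - P) k ⬝ᵥ (Phi - P) k) * √(W.col j ⬝ᵥ W.col j))
      ≤ 8 * κ * (ε * (2 * B)) := by gcongr
  have h4 : 4 * κ * t * (√((Phi - P) k ⬝ᵥ (Phi - P) k) * √(W.col j ⬝ᵥ W.col j))
      ≤ 4 * κ * 16 * (ε * (2 * B)) := by gcongr
  have h5 : 4 * κ * t * (√(P k ⬝ᵥ P k) * √(W.col j ⬝ᵥ W.col j))
      ≤ κ * τ * (B * (2 * B)) := by
    have : 4 * κ * t ≤ κ * τ := by nlinarith
    gcongr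
    exact mul_nonneg hκ (by linarith)
  refine (abs_add_three _ _ _).trans ?_
  nlinarith

/-- The constant of the recovery theorem, as a function of the eigenvalue bound `B` and of a
sub-Gaussian parameter `κ`. It is chosen so that `C' ε / (2B)` is the bound of `abs_clean_sub_le` for
`τ = 80 ε`. -/
noncomputable def recoveryConst (B κ : ℝ) : ℝ := 2 * B * (κ * (144 * B + 160 * B ^ 2))

/-- The non-asymptotic form of the recovery theorem: recovery can only fail where one of the two
estimators from the first half fails, or on an event of probability at most `4 / (p + q)`. The lower
bound on the signal is implicit in the window for the cut-off. -/
lemma measure_recoverSupp_ne_le (hB : 1 < B) {K κ : ℝ≥0} (hκ : 0 < κ) (hK : K ≤ κ)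
    (h : SubGaussianModel B K d μ U V) (hr : 1 ≤ d.r) {n : ℕ} (hn : 0 < n)
    (hlog : Real.log ((d.p : ℝ) + d.q) / n ≤ 1 / 4)
    {Uhat : (Fin (n / 2) → Obs d.p d.q) → Matrix (Fin d.p) (Fin d.r) ℝ}
    (hUm : ∀ i j, Measurable fun f => Uhat f i j)
    {Phi : (Fin (n / 2) → Obs d.p d.q) → Matrix (Fin d.q) (Fin d.q) ℝ}
    (hPm : ∀ i j, Measurable fun f => Phi f i j)
    {err : ℝ} (herr : |err| < 1 / (2 * B * √(d.r : ℝ)))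
    {ξ : ℝ} (hξ : 1 ≤ ξ)
    {cut : ℝ} (hcut : cut ∈ Set.Icc (recoveryConst B κ * epsilon ξ n μ / (2 * B))
      ((signal V / (recoveryConst B κ * epsilon ξ n μ) - 1) *
        (recoveryConst B κ * epsilon ξ n μ) / (2 * B))) :
    Measure.pi (fun _ : Fin n => μ)
        {ω | recoverSupp (Uhat (firstHalf ω)) (Phi (firstHalf ω)) (empCovXY ω) cut
          = rowSupp V}ᶜ ≤
      Measure.pi (fun _ : Fin (n / 2) => μ)
        {f | ∀ i, ∃ w : ℝ, (w = 1 ∨ w = -1) ∧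
          (w • (Uhat f).col i - U.col i) ⬝ᵥ covX μ *ᵥ (w • (Uhat f).col i - U.col i)
            < err ^ 2}ᶜ +
      Measure.pi (fun _ : Fin (n / 2) => μ)
        {f | ∀ k, √((Phi f - (covY μ)⁻¹) k ⬝ᵥ (Phi f - (covY μ)⁻¹) k) ≤ epsilon ξ n μ}ᶜ +
      ENNReal.ofReal (4 / ((d.p : ℝ) + d.q)) := by
  obtain ⟨hS, hsX, hsY⟩ := h
  have := hS.isProbabilityMeasure
  replace hsX := fun u hu => hasSubgaussianMGF_of_le (hsX u hu) hK
  replace hsY := fun v hv => hasSubgaussianMGF_of_le (hsY v hv) hK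
  have hB0 : 0 < B := by linarith
  have hκ' : (0 : ℝ) < κ := by exact_mod_cast hκ
  have hn' : (0 : ℝ) < n := by exact_mod_cast hn
  have hp1 : (1 : ℝ) ≤ d.p := by exact_mod_cast hr.trans hS.rank_le_p
  have hq1 : (1 : ℝ) ≤ d.q := by exact_mod_cast hr.trans hS.rank_le_q
  set N : ℝ := (d.p : ℝ) + d.q with hN
  have hN2 : 2 ≤ N := by linarith
  set L := Real.log N with hL
  have hL0 : 0 < L := Real.log_pos (by linarith)
  set ρ := √(L / n) with hρ
  have hρ0 : 0 < ρ := Real.sqrt_pos.2 (by positivity)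
  have hρsq : ρ ^ 2 = L / n := Real.sq_sqrt (by positivity)
  have hρ1 : ρ ≤ 1 / 2 := by
    rw [hρ, Real.sqrt_le_left (by norm_num)]
    linarith
  set ε := epsilon ξ n μ with hε
  have hρε : ρ ≤ ε := by
    have hs : (1 : ℝ) ≤ colSparsity (covY μ)⁻¹ := by
      exact_mod_cast hS.one_le_colSparsity_inv hB hr
    rw [hε, epsilon, ← one_mul ρ]
    refine mul_le_mul hξ (Real.sqrt_le_sqrt ?_) hρ0.le (by linarith)
    gcongr
    exact le_mul_of_one_le_right hL0.le hs
  have hε0 : 0 < ε := hρ0.trans_le hρε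
  set P := (covY μ)⁻¹ with hP
  have hProw : ∀ k, √(P k ⬝ᵥ P k) ≤ B := by
    intro k
    rw [Real.sqrt_le_left hB0.le]
    have := sum_inv_row_sq_le (c := 1 / B) (by positivity) (isHermitian_covY μ)
      hS.quadForm_covY_ge k
    simpa using this
  -- With `t = 20 √(log (p + q) / n)` each deviation event has probability at most `2 (p + q)⁻³`.
  set t := 20 * ρ with ht
  set c := ENNReal.ofReal (2 * N⁻¹ ^ 3) with hc
  have hdev : ∀ {a : (Fin (n / 2) → Obs d.p d.q) → Fin d.q → ℝ} (_ : Measurable a) (j : Fin d.r),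
      (Measure.pi fun _ : Fin n => μ)
        {ω | (4 * κ * t) * (√(a (firstHalf ω) ⬝ᵥ a (firstHalf ω)) *
            √((Uhat (firstHalf ω)).col j ⬝ᵥ (Uhat (firstHalf ω)).col j)) <
          |a (firstHalf ω) ⬝ᵥ (empCovXY ω)ᵀ *ᵥ (Uhat (firstHalf ω)).col j -
            a (firstHalf ω) ⬝ᵥ (covXY μ)ᵀ *ᵥ (Uhat (firstHalf ω)).col j|} ≤ c := by
    intro a ha j
    refine (measure_empCovXY_deviation_le hn hκ hS.meanX hS.meanY hsX hsY ha
      (b := fun f => (Uhat f).col j) (measurable_pi_lambda _ fun i => hUm i j)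
      (t := t) (by positivity) (by linarith)).trans ?_
    refine ENNReal.ofReal_le_ofReal ?_
    have hm : (n : ℝ) / 2 ≤ ((n - n / 2 : ℕ) : ℝ) := by
      rw [div_le_iff₀ (by norm_num)]
      have : n ≤ (n - n / 2) * 2 := by omega
      exact_mod_cast this
    have h1 : 3 * L ≤ ((n - n / 2 : ℕ) : ℝ) * t ^ 2 / 64 := by
      have : (n : ℝ) / 2 * t ^ 2 / 64 ≤ ((n - n / 2 : ℕ) : ℝ) * t ^ 2 / 64 := by gcongr
      refine le_trans ?_ this
      rw [ht, mul_pow, hρsq]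
      field_simp
      linarith
    have h2 : N⁻¹ ^ 3 = Real.exp (-(3 * L)) := by
      rw [Real.exp_neg, show (3 : ℝ) * L = ((3 : ℕ) : ℝ) * L by norm_num, Real.exp_nat_mul, hL,
        Real.exp_log (by linarith), inv_pow]
    rw [h2]
    gcongr
  set BU := {f : Fin (n / 2) → Obs d.p d.q | ∀ i, ∃ w : ℝ, (w = 1 ∨ w = -1) ∧
          (w • (Uhat f).col i - U.col i) ⬝ᵥ covX μ *ᵥ (w • (Uhat f).col i - U.col i)
            < err ^ 2} with hBU
  set BP := {f : Fin (n / 2) → Obs d.p d.q |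
    ∀ k, √((Phi f - P) k ⬝ᵥ (Phi f - P) k) ≤ ε} with hBP
  let E1 : Fin d.q × Fin d.r → Set (Fin n → Obs d.p d.q) := fun kj =>
    {ω | (4 * κ * t) * (√((Phi (firstHalf ω) - P) kj.1 ⬝ᵥ (Phi (firstHalf ω) - P) kj.1) *
            √((Uhat (firstHalf ω)).col kj.2 ⬝ᵥ (Uhat (firstHalf ω)).col kj.2)) <
          |(Phi (firstHalf ω) - P) kj.1 ⬝ᵥ (empCovXY ω)ᵀ *ᵥ (Uhat (firstHalf ω)).col kj.2 -
            (Phi (firstHalf ω) - P) kj.1 ⬝ᵥ (covXY μ)ᵀ *ᵥ (Uhat (firstHalf ω)).col kj.2|}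
  let E2 : Fin d.q × Fin d.r → Set (Fin n → Obs d.p d.q) := fun kj =>
    {ω | (4 * κ * t) * (√(P kj.1 ⬝ᵥ P kj.1) *
            √((Uhat (firstHalf ω)).col kj.2 ⬝ᵥ (Uhat (firstHalf ω)).col kj.2)) <
          |P kj.1 ⬝ᵥ (empCovXY ω)ᵀ *ᵥ (Uhat (firstHalf ω)).col kj.2 -
            P kj.1 ⬝ᵥ (covXY μ)ᵀ *ᵥ (Uhat (firstHalf ω)).col kj.2|}
  have hE1 : ∀ kj, (Measure.pi fun _ : Fin n => μ) (E1 kj) ≤ c := fun kj =>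
    hdev (a := fun f => (Phi f - P) kj.1)
      (measurable_pi_lambda _ fun i => (hPm kj.1 i).sub_const _) kj.2
  have hE2 : ∀ kj, (Measure.pi fun _ : Fin n => μ) (E2 kj) ≤ c := fun kj =>
    hdev (a := fun _ => P kj.1) measurable_const kj.2
  have hunion : ∀ E : Fin d.q × Fin d.r → Set (Fin n → Obs d.p d.q),
      (∀ kj, (Measure.pi fun _ : Fin n => μ) (E kj) ≤ c) →
      (Measure.pi fun _ : Fin n => μ) (⋃ kj, E kj) ≤ ENNReal.ofReal (2 / N) := by
    intro E hE
    refine (measure_iUnion_fintype_le _ _).trans ((Finset.sum_le_sum fun kj _ => hE kj).trans ?_)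
    rw [Finset.sum_const, Finset.card_univ, Fintype.card_prod, Fintype.card_fin, Fintype.card_fin,
      nsmul_eq_mul, hc, ← ENNReal.ofReal_natCast, ← ENNReal.ofReal_mul (by positivity)]
    refine ENNReal.ofReal_le_ofReal ?_
    have hrN : (d.r : ℝ) ≤ N := by
      have : (d.r : ℝ) ≤ d.p := by exact_mod_cast hS.rank_le_p
      linarith
    have hqN : (d.q : ℝ) ≤ N := by linarith
    push_cast
    calc (d.q : ℝ) * d.r * (2 * N⁻¹ ^ 3) ≤ N * N * (2 * N⁻¹ ^ 3) := by gcongr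
      _ = 2 / N := by field_simp
  have hsub : {ω | recoverSupp (Uhat (firstHalf ω)) (Phi (firstHalf ω)) (empCovXY ω) cut
          = rowSupp V}ᶜ ⊆
      (firstHalf ⁻¹' BUᶜ ∪ firstHalf ⁻¹' BPᶜ) ∪ ((⋃ kj, E1 kj) ∪ ⋃ kj, E2 kj) := by
    intro ω hω
    by_contra hnot
    simp only [Set.mem_union, Set.mem_preimage, Set.mem_compl_iff, Set.mem_iUnion, not_or, not_not,
      not_exists] at hnot
    obtain ⟨⟨hu, hphi⟩, h1, h2⟩ := hnot
    refine hω ?_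
    change recoverSupp _ _ _ _ = _
    have hC0 : 0 < recoveryConst B κ * ε := by
      have : 0 < recoveryConst B κ := by unfold recoveryConst; positivity
      positivity
    refine recoverSupp_eq_rowSupp (η := recoveryConst B κ * ε / (2 * B)) hB hS.canonical
      (isHermitian_covX μ) (isHermitian_covY μ) (hS.quadForm_covX_nonneg hB)
      (hS.quadForm_covY_nonneg hB) (hS.isUnit_det_covY hB) hS.rank hS.corr_ge hr herr hu ?_
      hcut.1 ?_
    · intro k j
      obtain ⟨w, hw, hwU⟩ := hu j
      have := abs_clean_sub_le (Phi := Phi (firstHalf ω)) (P := P) (S := covXY μ)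
        (Shat := empCovXY ω) (W := Uhat (firstHalf ω)) (κ := κ) (t := t) (τ := 80 * ε) (B := B)
        hκ'.le hB0.le (by positivity) (by linarith) hε0.le (hphi k) (hProw k)
        (hS.sqrt_col_le hB hr herr hw hwU) (by linarith)
        (abs_crossCov_le hκ hS.meanX hS.meanY hsX hsY _ _)
        (not_lt.1 (h1 (k, j))) (not_lt.1 (h2 (k, j)))
      refine this.trans (le_of_eq ?_)
      rw [recoveryConst]
      field_simp
      ring
    · have := hcut.2
      rw [sub_mul, div_mul_cancel₀ _ hC0.ne', one_mul, sub_div] at this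
      linarith
  calc _ ≤ _ := measure_mono hsub
    _ ≤ ((Measure.pi fun _ : Fin n => μ) (firstHalf ⁻¹' BUᶜ)
          + (Measure.pi fun _ : Fin n => μ) (firstHalf ⁻¹' BPᶜ))
        + (ENNReal.ofReal (2 / N) + ENNReal.ofReal (2 / N)) := by
        refine (measure_union_le _ _).trans (add_le_add (measure_union_le _ _) ?_)
        exact (measure_union_le _ _).trans (add_le_add (hunion _ hE1) (hunion _ hE2))
    _ ≤ _ := by
        rw [← ENNReal.ofReal_add (by positivity) (by positivity), ← add_div,
          show (2 : ℝ) + 2 = 4 by norm_num]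
        gcongr
        · exact measure_firstHalf_preimage_le _
        · exact measure_firstHalf_preimage_le _

end Recovery

section Asymptotics

variable {B : ℝ} {d : ℕ → Dims}

lemma HighDim.tendsto_log_div (hd : HighDim d) :
    Tendsto (fun n : ℕ => Real.log (((d n).p : ℝ) + (d n).q) / n) atTop (𝓝 0) := by
  have h1 := hd.log_isLittleO.tendsto_div_nhds_zero
  have h2 : Tendsto (fun n : ℕ => Real.log 2 / (n : ℝ)) atTop (𝓝 0) :=
    tendsto_const_div_atTop_nhds_zero_nat _
  have h3 := h2.add h1
  rw [add_zero] at h3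
  refine tendsto_of_tendsto_of_tendsto_of_le_of_le' tendsto_const_nhds h3 ?_ ?_
  · filter_upwards [hd.dim_tendsto.eventually_ge_atTop 1] with n hn
    have : (1 : ℝ) ≤ ((d n).p : ℝ) + (d n).q := by exact_mod_cast hn
    exact div_nonneg (Real.log_nonneg this) (by positivity)
  · filter_upwards [hd.dim_tendsto.eventually_ge_atTop 1] with n hn
    have h4 : (1 : ℝ) ≤ ((d n).p : ℝ) + (d n).q := by exact_mod_cast hn
    have h5 : 0 < max (d n).p (d n).q := by
      have : 1 ≤ (d n).p + (d n).q := hn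
      omega
    have h6 : (0 : ℝ) < (max (d n).p (d n).q : ℕ) := by exact_mod_cast h5
    rw [← add_div]
    gcongr
    rw [← Real.log_mul (by norm_num) h6.ne']
    refine Real.log_le_log (by linarith) ?_
    have : (d n).p + (d n).q ≤ 2 * max (d n).p (d n).q := by omega
    exact_mod_cast this

/-- Recovery for every precision matrix whose rows are within `ε_n` of the true ones in the
Euclidean norm. -/
theorem recoversSupport_of_row_error (hB : 1 < B) {K κ : ℝ≥0} (hκ : 0 < κ) (hK : K ≤ κ)
    (hd : HighDim d) {M : Model}
    (hM : ∀ n μ U V, M (d n) μ U V → SubGaussianModel B K (d n) μ U V)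
    {Uhat : UEstimator d} (hUm : ∀ n i j, Measurable fun ω => Uhat n ω i j)
    (hU : L2Consistent B d M Uhat)
    {Phi : (n : ℕ) → Measure (Obs (d n).p (d n).q) →
      (Fin (n / 2) → Obs (d n).p (d n).q) → Matrix (Fin (d n).q) (Fin (d n).q) ℝ}
    (hPm : ∀ n μ i j, Measurable fun ω => Phi n μ ω i j)
    {ξ : (n : ℕ) → Measure (Obs (d n).p (d n).q) → ℝ}
    (hξ : ∀ n μ U V, M (d n) μ U V → 1 ≤ ξ n μ)
    (hPhi : ∀ δ : ℝ≥0∞, 0 < δ → ∀ᶠ n in atTop, ∀ μ U V, M (d n) μ U V →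
      Measure.pi (fun _ : Fin (n / 2) => μ)
        {ω | ∀ k, √((Phi n μ ω - (covY μ)⁻¹) k ⬝ᵥ (Phi n μ ω - (covY μ)⁻¹) k)
          ≤ epsilon (ξ n μ) n μ}ᶜ ≤ δ) :
    RecoversSupport B (recoveryConst B κ) d M Uhat Phi ξ := by
  intro δ hδ
  obtain ⟨err, herr, hU⟩ := hU
  have hδ3 : 0 < δ / 3 := ENNReal.div_pos hδ.ne' (by norm_num)
  have hdim : Tendsto (fun n => ENNReal.ofReal (4 / (((d n).p : ℝ) + (d n).q))) atTop (𝓝 0) := by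
    have h1 : Tendsto (fun n => (((d n).p : ℝ) + (d n).q)) atTop atTop := by
      have := tendsto_natCast_atTop_atTop (R := ℝ).comp hd.dim_tendsto
      refine this.congr fun n => ?_
      simp
    have := ENNReal.tendsto_ofReal (h1.const_div_atTop 4)
    simpa using this
  filter_upwards [hU _ hδ3, hPhi _ hδ3, hdim.eventually_le_const hδ3,
    hd.tendsto_log_div.eventually_le_const (show (0 : ℝ) < 1 / 4 by norm_num),
    eventually_gt_atTop 0] with n h1 h2 h3 h4 h5 μ U V hμ _ cut hcut
  refine (measure_recoverSupp_ne_le hB hκ hK (hM n μ U V hμ) (hd.rank_pos n) h5 h4 (hUm n)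
    (hPm n μ) (herr n) (hξ n μ U V hμ) hcut).trans ?_
  calc _ ≤ δ / 3 + δ / 3 + δ / 3 := add_le_add (add_le_add (h1 μ U V hμ) (h2 μ U V hμ)) h3
    _ = δ := ENNReal.add_thirds δ

lemma log_dim_y_le {d : Dims} {μ : Measure (Obs d.p d.q)}
    {U : Matrix (Fin d.p) (Fin d.r) ℝ} {V : Matrix (Fin d.q) (Fin d.r) ℝ}
    (h : IsSparseCCA B d μ U V) (hr : 1 ≤ d.r) :
    Real.log d.q ≤ Real.log ((d.p : ℝ) + d.q) := by
  have : (1 : ℝ) ≤ d.q := by exact_mod_cast hr.trans h.rank_le_q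
  exact Real.log_le_log (by linarith) (by linarith [Nat.cast_nonneg (α := ℝ) d.p])

lemma IsSparseCCA.row_error_le_of_normInftyOne {d : Dims} {μ : Measure (Obs d.p d.q)}
    {U : Matrix (Fin d.p) (Fin d.r) ℝ} {V : Matrix (Fin d.q) (Fin d.r) ℝ}
    (h : IsSparseCCA B d μ U V) (hr : 1 ≤ d.r) {Cpre : ℝ} (hC : 1 ≤ Cpre) {n : ℕ}
    {Δ : Matrix (Fin d.q) (Fin d.q) ℝ}
    (hΔ : normInftyOne Δ ≤ Cpre * colSparsity (covY μ)⁻¹ * √(Real.log d.q / n)) (k : Fin d.q) :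
    √(Δ k ⬝ᵥ Δ k) ≤ epsilon (xiA Cpre μ) n μ := by
  refine (sqrt_row_le_normInftyOne _ k).trans (hΔ.trans ?_)
  have hlog := log_dim_y_le h hr
  rw [epsilon, xiA]
  set s : ℝ := ((colSparsity (covY μ)⁻¹ : ℕ) : ℝ)
  have hs0 : 0 ≤ s := Nat.cast_nonneg _
  rw [mul_comm (Real.log _) s, mul_div_assoc, Real.sqrt_mul hs0, mul_assoc Cpre √s,
    ← mul_assoc √s, Real.mul_self_sqrt hs0, ← mul_assoc]
  gcongr

lemma IsSparseCCA.row_error_le_of_normInftyTwo {d : Dims} {μ : Measure (Obs d.p d.q)}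
    {U : Matrix (Fin d.p) (Fin d.r) ℝ} {V : Matrix (Fin d.q) (Fin d.r) ℝ}
    (h : IsSparseCCA B d μ U V) (hr : 1 ≤ d.r) {Cpre : ℝ} (hC : 1 ≤ Cpre) {n : ℕ}
    {Δ : Matrix (Fin d.q) (Fin d.q) ℝ}
    (hΔ : normInftyTwo Δ ≤ Cpre * √(colSparsity (covY μ)⁻¹ * Real.log d.q / n)) (k : Fin d.q) :
    √(Δ k ⬝ᵥ Δ k) ≤ epsilon (xiB Cpre d n) n μ := by
  refine (sqrt_row_le_normInftyTwo _ k).trans (hΔ.trans ?_)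
  have hlog := log_dim_y_le h hr
  have hξ : Cpre ≤ xiB Cpre d n := le_mul_of_one_le_right (by linarith) (le_max_right _ _)
  rw [epsilon, mul_comm (Real.log _)]
  have h0 : 0 ≤ xiB Cpre d n := (by linarith : (0 : ℝ) ≤ Cpre).trans hξ
  gcongr

lemma recoveryConst_pos (hB : 1 < B) {κ : ℝ≥0} (hκ : 0 < κ) : 0 < recoveryConst B κ := by
  have hκ' : (0 : ℝ) < κ := by exact_mod_cast hκ
  unfold recoveryConst
  positivity

/-- The sub-Gaussian parameter is enlarged to `K + 1` only to have it positive. -/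
theorem recoversSupport_of_typeA (hB : 1 < B) (K : ℝ≥0) (hd : HighDim d) {Uhat : UEstimator d}
    (hUm : ∀ n i j, Measurable fun ω => Uhat n ω i j)
    (hU : L2Consistent B d (SubGaussianModel B K) Uhat)
    {Cpre : ℝ} {Phi : PrecisionEstimator d} (hC : 1 ≤ Cpre)
    (hPm : ∀ n i j, Measurable fun ω => Phi n ω i j)
    (hA : TypeA Cpre d (SubGaussianModel B K) Phi) :
    RecoversSupport B (recoveryConst B ((K + 1 : ℝ≥0) : ℝ)) d (SubGaussianModel B K) Uhat
      (fun n _ ω => Phi n ω) (fun _ μ => xiA Cpre μ) := by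
  refine recoversSupport_of_row_error (Phi := fun n _ ω => Phi n ω) (ξ := fun _ μ => xiA Cpre μ)
    hB (by positivity) le_self_add hd (fun n μ U V h => h) hUm hU (fun n _ => hPm n) ?_ ?_
  · intro n μ U V h
    have hs : (1 : ℝ) ≤ ((colSparsity (covY μ)⁻¹ : ℕ) : ℝ) := by
      exact_mod_cast h.1.one_le_colSparsity_inv hB (hd.rank_pos n)
    exact one_le_mul_of_one_le_of_one_le hC (Real.one_le_sqrt.2 hs)
  · intro δ hδ
    filter_upwards [hA δ hδ] with n hn μ U V h
    refine (measure_mono (Set.compl_subset_compl.2 ?_)).trans (hn μ U V h)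
    exact fun ω hω k => h.1.row_error_le_of_normInftyOne (hd.rank_pos n) hC hω k

theorem recoversSupport_of_typeB (hB : 1 < B) (hd : HighDim d) {Uhat : UEstimator d}
    (hUm : ∀ n i j, Measurable fun ω => Uhat n ω i j)
    (hU : L2Consistent B d (GaussianModel B) Uhat)
    {Cpre : ℝ} {Phi : PrecisionEstimator d} (hC : 1 ≤ Cpre)
    (hPm : ∀ n i j, Measurable fun ω => Phi n ω i j)
    (hBt : TypeB Cpre d (GaussianModel B) Phi) :
    RecoversSupport B (recoveryConst B (B.toNNReal : ℝ)) d (GaussianModel B) Uhat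
      (fun n _ ω => Phi n ω) (fun n _ => xiB Cpre (d n) n) := by
  refine recoversSupport_of_row_error (Phi := fun n _ ω => Phi n ω)
    (ξ := fun n _ => xiB Cpre (d n) n) hB (Real.toNNReal_pos.2 (by linarith)) le_rfl hd
    (fun n μ U V h => h.subGaussianModel) hUm hU (fun n _ => hPm n) ?_ ?_
  · exact fun n μ U V h => one_le_mul_of_one_le_of_one_le hC (le_max_right _ _)
  · intro δ hδ
    filter_upwards [hBt δ hδ] with n hn μ U V h
    refine (measure_mono (Set.compl_subset_compl.2 ?_)).trans (hn μ U V h)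
    exact fun ω hω k => h.1.row_error_le_of_normInftyTwo (hd.rank_pos n) hC hω k

theorem recoversSupport_of_typeC (hB : 1 < B) (K : ℝ≥0) (hd : HighDim d) {Uhat : UEstimator d}
    (hUm : ∀ n i j, Measurable fun ω => Uhat n ω i j)
    (hU : L2Consistent B d (SubGaussianModel B K) Uhat) :
    RecoversSupport B (recoveryConst B ((K + 1 : ℝ≥0) : ℝ)) d (SubGaussianModel B K) Uhat
      (fun _ μ _ => (covY μ)⁻¹) (fun _ _ => 1) := by
  refine recoversSupport_of_row_error (Phi := fun _ μ _ => (covY μ)⁻¹) (ξ := fun _ _ => 1)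
    hB (by positivity) le_self_add hd (fun n μ U V h => h) hUm hU
    (fun _ _ _ _ => measurable_const) (fun _ _ _ _ _ => le_rfl) ?_
  intro δ hδ
  refine Filter.Eventually.of_forall fun n μ U V _ => ?_
  have h0 : ∀ k : Fin (d n).q, √(((covY μ)⁻¹ - (covY μ)⁻¹) k ⬝ᵥ ((covY μ)⁻¹ - (covY μ)⁻¹) k)
      ≤ epsilon 1 n μ := by
    intro k
    rw [sub_self, show (0 : Matrix (Fin (d n).q) (Fin (d n).q) ℝ) k = 0 from rfl, dotProduct_zero,
      Real.sqrt_zero, epsilon]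
    positivity
  rw [Set.eq_univ_of_forall (s := {_ω | _}) fun _ => h0, Set.compl_univ, measure_empty]
  exact zero_le

end Asymptotics

end SparseCCA

theorem theorem1 (B : ℝ) (hB : 1 < B) :
    -- types A and C, uniformly over the sub-Gaussian model
    (∀ K : ℝ≥0, ∃ C' : ℝ, 0 < C' ∧
      ∀ (d : ℕ → SparseCCA.Dims) (Uhat : SparseCCA.UEstimator d), SparseCCA.HighDim d →
        (∀ n i j, Measurable fun ω => Uhat n ω i j) →
        SparseCCA.L2Consistent B d (SparseCCA.SubGaussianModel B K) Uhat →
        (∀ (Cpre : ℝ) (Phi : SparseCCA.PrecisionEstimator d), 1 ≤ Cpre →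
          (∀ n i j, Measurable fun ω => Phi n ω i j) →
          SparseCCA.TypeA Cpre d (SparseCCA.SubGaussianModel B K) Phi →
          SparseCCA.RecoversSupport B C' d (SparseCCA.SubGaussianModel B K) Uhat
            (fun n _ ω => Phi n ω) (fun _ μ => SparseCCA.xiA Cpre μ)) ∧
        SparseCCA.RecoversSupport B C' d (SparseCCA.SubGaussianModel B K) Uhat
          (fun _ μ _ => (SparseCCA.covY μ)⁻¹) (fun _ _ => 1)) ∧
    -- type B, uniformly over the Gaussian model
    (∃ C' : ℝ, 0 < C' ∧
      ∀ (d : ℕ → SparseCCA.Dims) (Uhat : SparseCCA.UEstimator d), SparseCCA.HighDim d →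
        (∀ n i j, Measurable fun ω => Uhat n ω i j) →
        SparseCCA.L2Consistent B d (SparseCCA.GaussianModel B) Uhat →
        ∀ (Cpre : ℝ) (Phi : SparseCCA.PrecisionEstimator d), 1 ≤ Cpre →
          (∀ n i j, Measurable fun ω => Phi n ω i j) →
          SparseCCA.TypeB Cpre d (SparseCCA.GaussianModel B) Phi →
          SparseCCA.RecoversSupport B C' d (SparseCCA.GaussianModel B) Uhat
            (fun n _ ω => Phi n ω) (fun n _ => SparseCCA.xiB Cpre (d n) n)) := by

  refine ⟨fun K => ⟨SparseCCA.recoveryConst B ((K + 1 : ℝ≥0) : ℝ),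
    SparseCCA.recoveryConst_pos hB (by positivity), fun d Uhat hd hUm hU => ⟨?_, ?_⟩⟩,
    SparseCCA.recoveryConst B (B.toNNReal : ℝ),
    SparseCCA.recoveryConst_pos hB (Real.toNNReal_pos.2 (by linarith)), ?_⟩
  · exact fun Cpre Phi hC hPm hA => SparseCCA.recoversSupport_of_typeA hB K hd hUm hU hC hPm hA
  · exact SparseCCA.recoversSupport_of_typeC hB K hd hUm hU
  · exact fun d Uhat hd hUm hU Cpre Phi hC hPm hBt =>
      SparseCCA.recoversSupport_of_typeB hB hd hUm hU hC hPm hBt
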